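/- Let $B^3_+=\{x\in\mathbb{R}^3:\ x_1^2+x_2^2+x_3^2\le 1,\ x_3\ge 0\}$ be the closed half ball, with Lebesgue measure, and for $n\ge 1$ let $\mathcal{P}_n$ be the space of real polynomials in three variables of total degree at most $n$. For $x\in\mathbb{R}^3$ put $C(\mathcal{P}_n,B^3_+,x)=\sum_k\phi_k(x)^2$, where $(\phi_k)$ is any orthonormal basis of $\mathcal{P}_n$ with respect to the inner product $\int_{B^3_+}fg\,dx$ (the value does not depend on the choice of the basis), and let $C(\mathcal{P}_n,B^3_+)=\sup_{x\in B^3_+}C(\mathcal{P}_n,B^3_+,x)$. Then there are absolute constants $c_1,c_2,c_3,c_4>0$ such that for every integer $n\ge 1$ $$c_1n^5\le C(\mathcal{P}_n,B^3_+)\le c_2n^5$$ and $$c_3n^{5/2}\le\sup_{\phi\in\mathcal{P}_n,\ \phi\ne 0}\frac{\|\phi\|_{L_\infty(B^3_+)}}{\|\phi\|_{L_2(B^3_+)}}\le c_4n^{5/2}.$$ -/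

import Mathlib

open MeasureTheory
open scoped ENNReal

noncomputable section

/-- The linear map sending a formal real polynomial in `d` variables to the corresponding
polynomial function on the Euclidean space `ℝ^d`. -/
def polyFun (d : ℕ) : MvPolynomial (Fin d) ℝ →ₗ[ℝ] (EuclideanSpace ℝ (Fin d) → ℝ) where
  toFun p := fun x => MvPolynomial.eval (fun i => x i) p
  map_add' p q := by ext x; simp
  map_smul' c p := by ext x; simp [MvPolynomial.smul_eval]

/-- The space `P_{n,d}` of algebraic polynomials of total degree at most `n` in `d` real variables,
as functions on `ℝ^d`. -/
def polySpace (d n : ℕ) : Submodule ℝ (EuclideanSpace ℝ (Fin d) → ℝ) :=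
  (MvPolynomial.restrictTotalDegree (Fin d) ℝ n).map (polyFun d)

/-- The finite family `φ` is an orthonormal basis of the space `S` of functions,
with respect to the inner product `∫_D f g dμ` (the functions are required to lie in `L_2(D, μ)`,
so that all these integrals exist). -/
structure IsOrthonormalBasisOn {α : Type*} [MeasurableSpace α] (S : Submodule ℝ (α → ℝ))
    (D : Set α) (μ : Measure α) {N : ℕ} (φ : Fin N → α → ℝ) : Prop where
  memLp : ∀ k, MemLp (φ k) 2 (μ.restrict D)
  orthonormal : ∀ k l, ∫ x in D, φ k x * φ l x ∂μ = if k = l then 1 else 0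
  span_eq : Submodule.span ℝ (Set.range φ) = S

theorem IsOrthonormalBasisOn.expand {α : Type*} [MeasurableSpace α] {S : Submodule ℝ (α → ℝ)}
    {D : Set α} {μ : Measure α} {N : ℕ} {φ : Fin N → α → ℝ} (h : IsOrthonormalBasisOn S D μ φ)
    {f : α → ℝ} (hf : f ∈ S) (x : α) :
    f x = ∑ k, (∫ y in D, f y * φ k y ∂μ) * φ k x := by
  rw [← h.span_eq] at hf
  obtain ⟨a, rfl⟩ := (Submodule.mem_span_range_iff_exists_fun ℝ).1 hf
  have key : ∀ k, ∫ y in D, (∑ i, a i • φ i) y * φ k y ∂μ = a k := by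
    intro k
    have h1 : ∀ y, (∑ i, a i • φ i) y * φ k y = ∑ i, a i * (φ i y * φ k y) := by
      intro y
      simp [Finset.sum_apply, Finset.sum_mul, mul_assoc]
    simp only [h1]
    rw [integral_finsetSum]
    · simp [integral_const_mul, h.orthonormal]
    · intro i _
      exact ((h.memLp i).integrable_mul (h.memLp k)).const_mul (a i)
  simp only [key]
  simp [Finset.sum_apply]

open Classical in
/-- The reciprocal `C(S, D, μ, x) = λ(S, D, μ, x)⁻¹` of the Christoffel function, that is
`∑ φ_k(x)^2` for an orthonormal basis `(φ_k)` of `S` with respect to `μ` on `D`.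
By `christoffelC_eq` every orthonormal basis gives the same value. The value is `0` if there is no
orthonormal basis. -/
def christoffelC {α : Type*} [MeasurableSpace α] (S : Submodule ℝ (α → ℝ))
    (D : Set α) (μ : Measure α) (x : α) : ℝ :=
  if h : ∃ (N : ℕ) (φ : Fin N → α → ℝ), IsOrthonormalBasisOn S D μ φ then
    ∑ k, (h.choose_spec.choose k x) ^ 2
  else 0

theorem christoffelC_eq {α : Type*} [MeasurableSpace α] {S : Submodule ℝ (α → ℝ)}
    {D : Set α} {μ : Measure α} {N : ℕ} {φ : Fin N → α → ℝ}
    (hφ : IsOrthonormalBasisOn S D μ φ) (x : α) :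
    christoffelC S D μ x = ∑ k, (φ k x) ^ 2 := by
  have hex : ∃ (N : ℕ) (φ : Fin N → α → ℝ), IsOrthonormalBasisOn S D μ φ := ⟨N, φ, hφ⟩
  rw [christoffelC, dif_pos hex]
  have hψ := hex.choose_spec.choose_spec
  set ψ := hex.choose_spec.choose
  have mφ : ∀ k, φ k ∈ S := fun k => hφ.span_eq ▸ Submodule.subset_span ⟨k, rfl⟩
  have mψ : ∀ k, ψ k ∈ S := fun k => hψ.span_eq ▸ Submodule.subset_span ⟨k, rfl⟩
  calc ∑ k, (ψ k x) ^ 2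
      = ∑ k, ψ k x * ∑ j, (∫ y in D, ψ k y * φ j y ∂μ) * φ j x := by
        refine Finset.sum_congr rfl fun k _ => ?_
        rw [← hφ.expand (mψ k) x, sq]
    _ = ∑ j, φ j x * ∑ k, (∫ y in D, φ j y * ψ k y ∂μ) * ψ k x := by
        simp only [Finset.mul_sum]
        rw [Finset.sum_comm]
        refine Finset.sum_congr rfl fun j _ => Finset.sum_congr rfl fun k _ => ?_
        simp only [mul_comm (φ j _) (ψ k _)]
        ring
    _ = ∑ j, (φ j x) ^ 2 := by
        refine Finset.sum_congr rfl fun j _ => ?_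
        rw [← hψ.expand (mφ j) x, sq]

/-- `C(S, D, μ) = sup_{x ∈ D} C(S, D, μ, x)`, with values in `[0, ∞]`. -/
def christoffelSup {α : Type*} [MeasurableSpace α] (S : Submodule ℝ (α → ℝ))
    (D : Set α) (μ : Measure α) : ℝ≥0∞ :=
  ⨆ x ∈ D, ENNReal.ofReal (christoffelC S D μ x)

/-- `sup ‖φ‖_{L_∞(D, μ)} / ‖φ‖_{L_2(D, μ)}` over all nonzero `φ ∈ S`, with values in `[0, ∞]`. -/
def nikolskiiSup {α : Type*} [MeasurableSpace α] (S : Submodule ℝ (α → ℝ))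
    (D : Set α) (μ : Measure α) : ℝ≥0∞ :=
  ⨆ φ ∈ S, ⨆ _ : φ ≠ 0, eLpNorm φ ∞ (μ.restrict D) / eLpNorm φ 2 (μ.restrict D)

/-- The half ball `B^3_+ = {x ∈ B_2^3 : x_3 ≥ 0}`, where `B_2^3` is the closed Euclidean unit ball
of `ℝ^3`. The third coordinate has index `2`. -/
def halfBall3 : Set (EuclideanSpace ℝ (Fin 3)) :=
  {x | ‖x‖ ≤ 1 ∧ 0 ≤ x 2}

/-- `a_n ≈ b_n` for `n ≥ 1`: there are constants `c₁, c₂ > 0`, independent of `n`, such that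
`c₁ b_n ≤ a_n ≤ c₂ b_n` for all integers `n ≥ 1`; in particular every `a_n` is finite. -/
def EquivOrder (a : ℕ → ℝ≥0∞) (b : ℕ → ℝ) : Prop :=
  ∃ c₁ c₂ : ℝ, 0 < c₁ ∧ 0 < c₂ ∧ ∀ n : ℕ, 1 ≤ n →
    ENNReal.ofReal (c₁ * b n) ≤ a n ∧ a n ≤ ENNReal.ofReal (c₂ * b n)

end

/-! Both pairs of bounds reduce to comparing `φ x ^ 2` with `n ^ 5` times the squared `L_2` norm of
`φ`: for every point of the half ball from above, and for one polynomial at the edge point `(1, 0,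
0)` from below.

Upper bound. Every point `x` of the half ball is the apex of an affine copy, inside the half ball
and of volume bounded below, of the region `0 ≤ t ≤ 1`, `|b| ≤ 1`, `b² ≤ a ≤ 2b²`
(`exists_affine_parabolicPrism_subset`). On this region one-variable estimates are applied twice.
Along the segment `(t, 0, 0)` the value at an endpoint costs `n²` (`sq_eval_zero_le_integral_Icc`).
From `(t, 0, 0)` one moves along the parabolas `b ↦ (t, b, κb²)`, `1 ≤ κ ≤ 2`; averaging over `κ`
produces the Jacobian `b²`, and the value at `0` against the weight `b²` costs `n³`
(`sq_eval_zero_le_integral_sq_weight`). Both estimates come from one kernel reproducing `P(1)`,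
bounded in two ways.

Lower bound. The polynomial `U_m(x_1)² U_m(1 - 2x_3)²` with `4m ≤ n` equals `(m + 1)⁴` at the edge
point, while its squared norm is `O(m³)`: the face `x_3 = 0` contributes `m²`, and the direction
`x_1`, whose slices have width `2√(1 - x_1²)` in `x_2`, contributes `m`.

The Christoffel function at `x` is the best constant in such a pointwise inequality, and the
Nikolskii constant is obtained by taking square roots. -/

/-! ### One-variable estimates from the endpoint kernel -/

theorem integral_cos_int_mul {k : ℤ} (hk : k ≠ 0) :
    ∫ θ in (0 : ℝ)..Real.pi, Real.cos (k * θ) = 0 := by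
  have hk' : (k : ℝ) ≠ 0 := by exact_mod_cast hk
  rw [intervalIntegral.integral_comp_mul_left (fun x => Real.cos x) hk']
  simp [Real.sin_int_mul_pi]

theorem integral_sin_mul_sin_nat (j k : ℕ) :
    ∫ θ in (0 : ℝ)..Real.pi, Real.sin ((j + 1) * θ) * Real.sin ((k + 1) * θ)
      = if j = k then Real.pi / 2 else 0 := by
  have h : ∀ θ : ℝ, Real.sin ((j + 1) * θ) * Real.sin ((k + 1) * θ)
      = (Real.cos (((j - k : ℤ) : ℝ) * θ) - Real.cos (((j + k + 2 : ℤ) : ℝ) * θ)) / 2 := by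
    intro θ
    have e1 : ((j - k : ℤ) : ℝ) * θ = (j + 1) * θ - (k + 1) * θ := by push_cast; ring
    have e2 : ((j + k + 2 : ℤ) : ℝ) * θ = (j + 1) * θ + (k + 1) * θ := by push_cast; ring
    rw [e1, e2, Real.cos_sub, Real.cos_add]; ring
  simp only [h]
  rw [intervalIntegral.integral_div, intervalIntegral.integral_sub
    (Continuous.intervalIntegrable (by fun_prop) _ _)
    (Continuous.intervalIntegrable (by fun_prop) _ _),
    integral_cos_int_mul (k := (j + k + 2 : ℤ)) (by omega)]
  split_ifs with hjk
  · subst hjk; simp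
  · rw [integral_cos_int_mul (k := (j - k : ℤ)) (by omega)]; simp

/-- A multiple of the kernel which reproduces the value at the endpoint `1` of polynomials of degree
at most `m`, in the variable `θ = arccos x`. -/
noncomputable def endpointKernel (m : ℕ) (θ : ℝ) : ℝ :=
  ∑ k ∈ Finset.range (m + 1), ((k : ℝ) + 1) * Real.sin ((k + 1) * θ)

theorem continuous_endpointKernel (m : ℕ) : Continuous (endpointKernel m) := by
  unfold endpointKernel; fun_prop

theorem abs_sin_nat_succ_mul_le (k : ℕ) {θ : ℝ} (hθ : 0 ≤ Real.sin θ) :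
    |Real.sin ((k + 1) * θ)| ≤ (k + 1) * Real.sin θ := by
  induction k with
  | zero => simp [abs_of_nonneg hθ]
  | succ k ih =>
    have e : ((k + 1 : ℕ) + 1 : ℝ) * θ = (k + 1) * θ + θ := by push_cast; ring
    rw [e, Real.sin_add]
    calc |Real.sin ((k + 1) * θ) * Real.cos θ + Real.cos ((k + 1) * θ) * Real.sin θ|
        ≤ |Real.sin ((k + 1) * θ) * Real.cos θ| + |Real.cos ((k + 1) * θ) * Real.sin θ| :=
          abs_add_le _ _
      _ ≤ |Real.sin ((k + 1) * θ)| * 1 + 1 * Real.sin θ := by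
          rw [abs_mul, abs_mul, abs_of_nonneg hθ]
          gcongr
          · exact Real.abs_cos_le_one _
          · exact Real.abs_cos_le_one _
      _ ≤ _ := by push_cast; linarith

theorem abs_endpointKernel_le (m : ℕ) (θ : ℝ) : |endpointKernel m θ| ≤ (m + 1) ^ 2 := by
  calc |endpointKernel m θ| ≤ ∑ k ∈ Finset.range (m + 1), |((k : ℝ) + 1) * Real.sin ((k + 1) * θ)| :=
        Finset.abs_sum_le_sum_abs _ _
    _ ≤ ∑ k ∈ Finset.range (m + 1), ((m : ℝ) + 1) := by
        refine Finset.sum_le_sum fun k hk => ?_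
        have hk' : (k : ℝ) ≤ m := by exact_mod_cast Nat.lt_succ_iff.1 (Finset.mem_range.1 hk)
        rw [abs_mul, abs_of_nonneg (by positivity)]
        nlinarith [Real.abs_sin_le_one ((k + 1) * θ), abs_nonneg (Real.sin ((k + 1) * θ)),
          (Nat.cast_nonneg k : (0 : ℝ) ≤ k)]
    _ = (m + 1) ^ 2 := by simp; ring

theorem abs_endpointKernel_le_mul_sin (m : ℕ) {θ : ℝ} (hθ : 0 ≤ Real.sin θ) :
    |endpointKernel m θ| ≤ (m + 1) ^ 3 * Real.sin θ := by
  calc |endpointKernel m θ| ≤ ∑ k ∈ Finset.range (m + 1), |((k : ℝ) + 1) * Real.sin ((k + 1) * θ)| :=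
        Finset.abs_sum_le_sum_abs _ _
    _ ≤ ∑ k ∈ Finset.range (m + 1), ((m : ℝ) + 1) ^ 2 * Real.sin θ := by
        refine Finset.sum_le_sum fun k hk => ?_
        have hk' : (k : ℝ) ≤ m := by exact_mod_cast Nat.lt_succ_iff.1 (Finset.mem_range.1 hk)
        rw [abs_mul, abs_of_nonneg (by positivity)]
        calc ((k : ℝ) + 1) * |Real.sin ((k + 1) * θ)|
            ≤ (m + 1) * ((m + 1) * Real.sin θ) := by
              gcongr
              exact (abs_sin_nat_succ_mul_le k hθ).trans (by gcongr)
          _ = _ := by ring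
    _ = (m + 1) ^ 3 * Real.sin θ := by simp; ring

open Polynomial in
theorem integral_U_mul_endpointKernel {j m : ℕ} (h : j ≤ m) :
    ∫ θ in (0 : ℝ)..Real.pi,
      (Chebyshev.U ℝ j).eval (Real.cos θ) * Real.sin θ * endpointKernel m θ
      = Real.pi / 2 * (Chebyshev.U ℝ j).eval 1 := by
  have e : ∀ θ : ℝ, (Chebyshev.U ℝ j).eval (Real.cos θ) * Real.sin θ * endpointKernel m θ
      = ∑ k ∈ Finset.range (m + 1),
        ((k : ℝ) + 1) * (Real.sin ((j + 1) * θ) * Real.sin ((k + 1) * θ)) := by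
    intro θ
    rw [Chebyshev.U_real_cos, endpointKernel, Finset.mul_sum]
    refine Finset.sum_congr rfl fun k _ => ?_
    push_cast; ring
  simp only [e]
  rw [intervalIntegral.integral_finsetSum
    (fun k _ => Continuous.intervalIntegrable (by fun_prop) _ _)]
  simp only [intervalIntegral.integral_const_mul, integral_sin_mul_sin_nat]
  simp [h, mul_comm]

-- It suffices to test on `U_j`, `j ≤ m`: there `U_j(cos θ) sin θ = sin((j + 1)θ)`, and
-- orthogonality of the sines picks out the coefficient `j + 1 = U_j(1)`.
open Polynomial in
theorem integral_mul_endpointKernel {m : ℕ} (P : ℝ[X]) (hP : P.natDegree ≤ m) :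
    ∫ θ in (0 : ℝ)..Real.pi, P.eval (Real.cos θ) * Real.sin θ * endpointKernel m θ
      = Real.pi / 2 * P.eval 1 := by
  have hK := continuous_endpointKernel m
  suffices H : ∀ d ≤ m + 1, ∀ P : ℝ[X], P.degree < d →
      ∫ θ in (0 : ℝ)..Real.pi, P.eval (Real.cos θ) * Real.sin θ * endpointKernel m θ
        = Real.pi / 2 * P.eval 1 by
    refine H (m + 1) le_rfl P ?_
    exact (degree_le_of_natDegree_le hP).trans_lt (by exact_mod_cast Nat.lt_succ_self m)
  intro d
  induction d with
  | zero =>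
    intro _ P hP
    have : P = 0 := by simpa using hP
    simp [this]
  | succ d ih =>
    intro hd P hP
    have hU : (Chebyshev.U ℝ d).coeff d ≠ 0 := by
      have := Chebyshev.natDegree_U_natCast ℝ d
      conv => lhs; arg 2; rw [← this]
      rw [coeff_natDegree, leadingCoeff_ne_zero]
      exact Chebyshev.U_ne_zero ℝ d (by omega)
    obtain ⟨c, hc⟩ : ∃ c : ℝ, c * (Chebyshev.U ℝ d).coeff d = P.coeff d :=
      ⟨P.coeff d / (Chebyshev.U ℝ d).coeff d, div_mul_cancel₀ _ hU⟩
    -- Subtracting the right multiple of `U_d` cancels the leading term, so the induction runs on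
    -- the degree.
    have hQ : (P - C c * Chebyshev.U ℝ d).degree < d := by
      rw [degree_lt_iff_coeff_zero] at hP ⊢
      intro k hk
      rw [coeff_sub, coeff_C_mul]
      rcases hk.eq_or_lt with rfl | hk
      · rw [hc, sub_self]
      · rw [hP k hk, coeff_eq_zero_of_natDegree_lt (by rwa [Chebyshev.natDegree_U_natCast])]
        simp
    have h1 := ih (by omega) _ hQ
    have h2 := integral_U_mul_endpointKernel (show d ≤ m by omega)
    have e : ∀ θ : ℝ, P.eval (Real.cos θ) * Real.sin θ * endpointKernel m θ
        = (P - C c * Chebyshev.U ℝ d).eval (Real.cos θ) * Real.sin θ * endpointKernel m θ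
          + c * ((Chebyshev.U ℝ d).eval (Real.cos θ) * Real.sin θ * endpointKernel m θ) := by
      intro θ; simp only [eval_sub, eval_mul, eval_C]; ring
    simp only [e]
    rw [intervalIntegral.integral_add (Continuous.intervalIntegrable (by fun_prop) _ _)
      (Continuous.intervalIntegrable (by fun_prop) _ _), intervalIntegral.integral_const_mul,
      h1, h2]
    simp; ring

-- The kernel is applied to `p²` itself, transported to `[-1, 1]` with `0` going to `1`. Since `p² ≥
-- 0`, the uniform bound `(2n + 1)²` on the kernel is all that is needed.
open Polynomial in
theorem sq_eval_zero_le_integral_Icc {n : ℕ} (hn : 1 ≤ n) (p : ℝ[X]) (hp : p.natDegree ≤ n) :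
    p.eval 0 ^ 2 ≤ 12 * n ^ 2 * ∫ t in (0 : ℝ)..1, p.eval t ^ 2 := by
  have hn' : (1 : ℝ) ≤ n := by exact_mod_cast hn
  set P : ℝ[X] := (p ^ 2).comp (C (1 / 2) * (1 - X)) with hPdef
  have hPe : ∀ x, P.eval x = p.eval ((1 - x) / 2) ^ 2 := by
    intro x; simp [hPdef, eval_comp]; ring_nf
  have hPd : P.natDegree ≤ 2 * n := by
    refine natDegree_comp_le.trans ?_
    have h1 : (p ^ 2).natDegree ≤ 2 * n := natDegree_pow_le.trans (by gcongr)
    have h2 : (C (1 / 2 : ℝ) * (1 - X)).natDegree ≤ 1 := by compute_degree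
    nlinarith
  have key := integral_mul_endpointKernel P hPd
  have hK := continuous_endpointKernel (2 * n)
  have hI : 0 ≤ ∫ t in (0 : ℝ)..1, p.eval t ^ 2 :=
    intervalIntegral.integral_nonneg (by norm_num) fun t _ => sq_nonneg _
  have hsub : ∫ θ in (0 : ℝ)..Real.pi, P.eval (Real.cos θ) * Real.sin θ
      = 2 * ∫ t in (0 : ℝ)..1, p.eval t ^ 2 := by
    have := intervalIntegral.integral_comp_mul_deriv (a := 0) (b := Real.pi)
      (f := fun θ => (1 - Real.cos θ) / 2) (f' := fun θ => Real.sin θ / 2)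
      (g := fun t => p.eval t ^ 2)
      (fun θ _ => by simpa using ((Real.hasDerivAt_cos θ).const_sub 1).div_const 2)
      (by fun_prop) (by fun_prop)
    simp only [Function.comp_def] at this
    norm_num at this
    rw [← this, ← intervalIntegral.integral_const_mul]
    refine intervalIntegral.integral_congr fun θ _ => ?_
    simp only [hPe]; ring
  have hle : ∫ θ in (0 : ℝ)..Real.pi, P.eval (Real.cos θ) * Real.sin θ * endpointKernel (2 * n) θ
      ≤ ∫ θ in (0 : ℝ)..Real.pi, ((2 * n + 1) ^ 2) * (P.eval (Real.cos θ) * Real.sin θ) := by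
    refine intervalIntegral.integral_mono_on Real.pi_pos.le
      (Continuous.intervalIntegrable (by fun_prop) _ _)
      (Continuous.intervalIntegrable (by fun_prop) _ _) fun θ hθ => ?_
    have h0 : 0 ≤ P.eval (Real.cos θ) * Real.sin θ :=
      mul_nonneg (by rw [hPe]; positivity) (Real.sin_nonneg_of_mem_Icc hθ)
    have h1 := (le_abs_self _).trans (abs_endpointKernel_le (2 * n) θ)
    push_cast at h1
    rw [mul_comm ((2 * (n : ℝ) + 1) ^ 2)]
    gcongr
  rw [key, intervalIntegral.integral_const_mul, hsub, hPe] at hle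
  norm_num at hle
  have h3 : (3 : ℝ) / 2 * p.eval 0 ^ 2 ≤ Real.pi / 2 * p.eval 0 ^ 2 := by
    gcongr; exact Real.pi_gt_three.le
  have h4 : (2 * (n : ℝ) + 1) ^ 2 ≤ 9 * n ^ 2 := by nlinarith
  nlinarith [mul_le_mul_of_nonneg_right h4 hI]

-- `G` collects the coefficients of even index.
open Polynomial in
theorem exists_even_part (m : ℕ) (P : ℝ[X]) (hP : P.natDegree ≤ 2 * m) :
    ∃ G : ℝ[X], G.natDegree ≤ m ∧ ∀ b : ℝ, 2 * G.eval (b ^ 2) = P.eval b + P.eval (-b) := by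
  refine ⟨∑ k ∈ Finset.range (m + 1), C (P.coeff (2 * k)) * X ^ k, ?_, fun b => ?_⟩
  · refine natDegree_sum_le_of_forall_le _ _ fun k hk => ?_
    exact (natDegree_C_mul_X_pow_le _ _).trans (Nat.lt_succ_iff.1 (Finset.mem_range.1 hk))
  · have h : ∀ x, P.eval x = ∑ i ∈ Finset.range (2 * (m + 1)), P.coeff i * x ^ i := fun x =>
      eval_eq_sum_range' (by omega) x
    rw [h, h, ← Finset.sum_add_distrib]
    have aux : ∀ N : ℕ, ∑ i ∈ Finset.range (2 * N), (P.coeff i * b ^ i + P.coeff i * (-b) ^ i)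
        = 2 * ∑ k ∈ Finset.range N, P.coeff (2 * k) * (b ^ 2) ^ k := by
      intro N
      induction N with
      | zero => simp
      | succ N ih =>
        rw [show 2 * (N + 1) = 2 * N + 1 + 1 by ring, Finset.sum_range_succ,
          Finset.sum_range_succ, ih, Finset.sum_range_succ,
          (even_two_mul N).neg_pow, (odd_two_mul_add_one N).neg_pow]
        ring
    rw [aux]
    simp [eval_finsetSum]

-- Replacing `q²` by its even part `G(b²)` halves the degree, so with `b = sin(θ/2)` it becomes a
-- polynomial of degree at most `2n` in `cos θ`. The kernel bound `(2n + 1)³ sin θ` supplies a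
-- second factor `sin θ`, and `sin² θ` carries the weight `b²`. The degree allowed is `2n` because
-- `q` will be a polynomial of degree `n` restricted to a parabola.
open Polynomial in
theorem sq_eval_zero_le_integral_sq_weight {n : ℕ} (hn : 1 ≤ n) (q : ℝ[X])
    (hq : q.natDegree ≤ 2 * n) :
    q.eval 0 ^ 2 ≤ 144 * n ^ 3 * ∫ b in (-1 : ℝ)..1, q.eval b ^ 2 * b ^ 2 := by
  have hn' : (1 : ℝ) ≤ n := by exact_mod_cast hn
  obtain ⟨G, hGd, hG⟩ := exists_even_part (2 * n) (q ^ 2)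
    (natDegree_pow_le.trans (by gcongr))
  simp only [eval_pow] at hG
  have hG0 : ∀ b : ℝ, 0 ≤ G.eval (b ^ 2) := fun b => by
    nlinarith [hG b, sq_nonneg (q.eval b), sq_nonneg (q.eval (-b))]
  set P : ℝ[X] := G.comp (C (1 / 2) * (1 - X)) with hPdef
  have hPe : ∀ θ : ℝ, P.eval (Real.cos θ) = G.eval (Real.sin (θ / 2) ^ 2) := by
    intro θ
    have : Real.cos θ = 1 - 2 * Real.sin (θ / 2) ^ 2 := by
      rw [Real.sin_sq_eq_half_sub]; ring_nf
    simp only [hPdef, eval_comp, eval_mul, eval_C, eval_sub, eval_one, eval_X, this]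
    ring_nf
  have hPd : P.natDegree ≤ 2 * n := by
    refine natDegree_comp_le.trans ?_
    have h2 : (C (1 / 2 : ℝ) * (1 - X)).natDegree ≤ 1 := by compute_degree
    nlinarith
  have key := integral_mul_endpointKernel P hPd
  have hK := continuous_endpointKernel (2 * n)
  have hP1 : P.eval 1 = q.eval 0 ^ 2 := by
    have := hPe 0
    have h0 := hG 0
    simp at this h0
    linarith
  have hsub : ∫ θ in (0 : ℝ)..Real.pi,
      P.eval (Real.cos θ) * Real.sin (θ / 2) ^ 2 * (Real.cos (θ / 2) / 2)
      = ∫ b in (0 : ℝ)..1, G.eval (b ^ 2) * b ^ 2 := by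
    have := intervalIntegral.integral_comp_mul_deriv (a := 0) (b := Real.pi)
      (f := fun θ => Real.sin (θ / 2)) (f' := fun θ => Real.cos (θ / 2) / 2)
      (g := fun b => G.eval (b ^ 2) * b ^ 2)
      (fun θ _ => by
        simpa [div_eq_mul_inv] using ((hasDerivAt_id θ).div_const 2).sin)
      (by fun_prop) (by fun_prop)
    simp only [Function.comp_def, Real.sin_pi_div_two, zero_div, Real.sin_zero] at this
    rw [← this]
    refine intervalIntegral.integral_congr fun θ _ => ?_
    simp only [hPe]
  have heven : ∫ b in (-1 : ℝ)..1, q.eval b ^ 2 * b ^ 2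
      = 2 * ∫ b in (0 : ℝ)..1, G.eval (b ^ 2) * b ^ 2 := by
    rw [← intervalIntegral.integral_add_adjacent_intervals (b := 0)
      (Continuous.intervalIntegrable (by fun_prop) _ _)
      (Continuous.intervalIntegrable (by fun_prop) _ _)]
    have h1 : ∫ b in (-1 : ℝ)..0, q.eval b ^ 2 * b ^ 2
        = ∫ b in (0 : ℝ)..1, q.eval (-b) ^ 2 * (-b) ^ 2 := by
      rw [intervalIntegral.integral_comp_neg (fun b => q.eval b ^ 2 * b ^ 2)]
      simp
    rw [h1, ← intervalIntegral.integral_add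
      (Continuous.intervalIntegrable (by fun_prop) _ _)
      (Continuous.intervalIntegrable (by fun_prop) _ _), ← intervalIntegral.integral_const_mul]
    refine intervalIntegral.integral_congr fun b _ => ?_
    rw [← mul_assoc, hG b]; ring
  have hle : ∫ θ in (0 : ℝ)..Real.pi, P.eval (Real.cos θ) * Real.sin θ * endpointKernel (2 * n) θ
      ≤ ∫ θ in (0 : ℝ)..Real.pi, (8 * (2 * n + 1) ^ 3) *
        (P.eval (Real.cos θ) * Real.sin (θ / 2) ^ 2 * (Real.cos (θ / 2) / 2)) := by
    refine intervalIntegral.integral_mono_on Real.pi_pos.le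
      (Continuous.intervalIntegrable (by fun_prop) _ _)
      (Continuous.intervalIntegrable (by fun_prop) _ _) fun θ hθ => ?_
    have hs := Real.sin_nonneg_of_mem_Icc hθ
    have hP0 : 0 ≤ P.eval (Real.cos θ) := by rw [hPe]; exact hG0 _
    have h1 := (le_abs_self _).trans (abs_endpointKernel_le_mul_sin (2 * n) hs)
    push_cast at h1
    have hc : 0 ≤ Real.cos (θ / 2) := Real.cos_nonneg_of_mem_Icc
      ⟨by linarith [hθ.1, Real.pi_pos], by linarith [hθ.2]⟩
    have hc1 := Real.cos_le_one (θ / 2)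
    have hsin : Real.sin θ = 2 * Real.sin (θ / 2) * Real.cos (θ / 2) := by
      rw [← Real.sin_two_mul]; ring_nf
    -- One of the two factors `cos(θ/2)` is dropped; the other is twice the Jacobian of `b =
    -- sin(θ/2)`.
    have h2 : Real.sin θ ^ 2 ≤ 4 * Real.sin (θ / 2) ^ 2 * Real.cos (θ / 2) := by
      rw [hsin]
      nlinarith [mul_nonneg (sq_nonneg (Real.sin (θ / 2))) (mul_nonneg hc (sub_nonneg.2 hc1))]
    calc P.eval (Real.cos θ) * Real.sin θ * endpointKernel (2 * n) θ
        ≤ P.eval (Real.cos θ) * Real.sin θ * ((2 * n + 1) ^ 3 * Real.sin θ) := by gcongr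
      _ = P.eval (Real.cos θ) * (2 * n + 1) ^ 3 * Real.sin θ ^ 2 := by ring
      _ ≤ P.eval (Real.cos θ) * (2 * n + 1) ^ 3 *
          (4 * Real.sin (θ / 2) ^ 2 * Real.cos (θ / 2)) := by gcongr
      _ = _ := by ring
  rw [key, intervalIntegral.integral_const_mul, hsub, hP1] at hle
  have hI : 0 ≤ ∫ b in (0 : ℝ)..1, G.eval (b ^ 2) * b ^ 2 :=
    intervalIntegral.integral_nonneg (by norm_num) fun t _ => mul_nonneg (hG0 _) (sq_nonneg _)
  have h3 : (3 : ℝ) / 2 * q.eval 0 ^ 2 ≤ Real.pi / 2 * q.eval 0 ^ 2 := by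
    gcongr; exact Real.pi_gt_three.le
  have h4 : (2 * (n : ℝ) + 1) ^ 3 ≤ (3 * n) ^ 3 := by gcongr; linarith
  rw [heven]
  nlinarith [mul_le_mul_of_nonneg_right h4 hI]

/-! ### The estimate at the apex of the parabolic prism -/

theorem lintegral_fin_three {f : (Fin 3 → ℝ) → ℝ≥0∞} (hf : Measurable f) :
    ∫⁻ y, f y = ∫⁻ a, ∫⁻ b, ∫⁻ c, f ![a, b, c] := by
  have e3 := (volume_preserving_piFinSuccAbove (fun _ : Fin 3 => ℝ) 0).symm
  have e2 := (volume_preserving_piFinSuccAbove (fun _ : Fin 2 => ℝ) 0).symm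
  have e1 := (volume_preserving_funUnique (Fin 1) ℝ).symm
  rw [← e3.lintegral_comp hf, Measure.volume_eq_prod, lintegral_prod (fun z => f
      ((MeasurableEquiv.piFinSuccAbove (fun _ : Fin 3 => ℝ) 0).symm z))
    (hf.comp e3.measurable).aemeasurable]
  refine lintegral_congr fun a => ?_
  have hf2 : Measurable fun z : Fin 2 → ℝ =>
      f ((MeasurableEquiv.piFinSuccAbove (fun _ : Fin 3 => ℝ) 0).symm (a, z)) :=
    hf.comp (e3.measurable.comp measurable_prodMk_left)
  change ∫⁻ z : Fin 2 → ℝ, f ((MeasurableEquiv.piFinSuccAbove (fun _ : Fin 3 => ℝ) 0).symm (a, z))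
    = _
  rw [← e2.lintegral_comp hf2, Measure.volume_eq_prod, lintegral_prod (fun z => f
      ((MeasurableEquiv.piFinSuccAbove (fun _ : Fin 3 => ℝ) 0).symm
        (a, (MeasurableEquiv.piFinSuccAbove (fun _ : Fin 2 => ℝ) 0).symm z)))
    (hf2.comp e2.measurable).aemeasurable]
  refine lintegral_congr fun b => ?_
  have hf1 : Measurable fun z : Fin 1 → ℝ =>
      f ((MeasurableEquiv.piFinSuccAbove (fun _ : Fin 3 => ℝ) 0).symm
        (a, (MeasurableEquiv.piFinSuccAbove (fun _ : Fin 2 => ℝ) 0).symm (b, z))) :=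
    hf2.comp (e2.measurable.comp measurable_prodMk_left)
  change ∫⁻ z : Fin 1 → ℝ, f ((MeasurableEquiv.piFinSuccAbove (fun _ : Fin 3 => ℝ) 0).symm
        (a, (MeasurableEquiv.piFinSuccAbove (fun _ : Fin 2 => ℝ) 0).symm (b, z))) = _
  refine (e1.lintegral_comp hf1).symm.trans (lintegral_congr fun c => congrArg f ?_)
  funext i
  fin_cases i <;> rfl

theorem ofReal_intervalIntegral {a b : ℝ} (hab : a ≤ b) {f : ℝ → ℝ} (hf : Continuous f)
    (h0 : ∀ x, 0 ≤ f x) :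
    ENNReal.ofReal (∫ x in a..b, f x) = ∫⁻ x in Set.Icc a b, ENNReal.ofReal (f x) := by
  rw [intervalIntegral.integral_of_le hab, ← integral_Icc_eq_integral_Ioc,
    ofReal_integral_eq_lintegral_ofReal hf.integrableOn_Icc (Filter.Eventually.of_forall h0)]

/-- This is the substitution `a = cκ`, used with `c = b²`. The case `c = 0` is needed because the
parabolas meet at `b = 0`. -/
theorem lintegral_Icc_one_two_scale_le {g : ℝ → ℝ≥0∞} (hg : Measurable g) {c : ℝ} (hc : 0 ≤ c) :
    ∫⁻ κ in Set.Icc (1 : ℝ) 2, g (c * κ) * ENNReal.ofReal c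
      ≤ ∫⁻ a in Set.Icc c (2 * c), g a := by
  rcases hc.eq_or_lt with rfl | hc
  · simp
  have hm : Measurable ((Set.Icc c (2 * c)).indicator g) := hg.indicator measurableSet_Icc
  have h := lintegral_map (μ := volume) hm (measurable_const_mul c)
  rw [Real.map_volume_mul_left hc.ne', lintegral_smul_measure,
    lintegral_indicator measurableSet_Icc, smul_eq_mul] at h
  have h2 : ∫⁻ κ in Set.Icc (1 : ℝ) 2, g (c * κ)
      = ∫⁻ κ, (Set.Icc c (2 * c)).indicator g (c * κ) := by
    rw [← lintegral_indicator measurableSet_Icc]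
    refine lintegral_congr fun κ => ?_
    have : κ ∈ Set.Icc (1 : ℝ) 2 ↔ c * κ ∈ Set.Icc c (2 * c) := by
      simp only [Set.mem_Icc]
      constructor
      · rintro ⟨h1, h2⟩; constructor <;> nlinarith
      · rintro ⟨h1, h2⟩; constructor <;> nlinarith
    by_cases hκ : κ ∈ Set.Icc (1 : ℝ) 2
    · rw [Set.indicator_of_mem hκ, Set.indicator_of_mem (this.1 hκ)]
    · rw [Set.indicator_of_notMem hκ, Set.indicator_of_notMem (fun h => hκ (this.2 h))]
  rw [lintegral_mul_const _ (by fun_prop), h2, ← h, mul_comm, ← mul_assoc,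
    ← ENNReal.ofReal_mul hc.le, abs_of_pos (inv_pos.2 hc), mul_inv_cancel₀ hc.ne']
  simp

open Polynomial in
theorem exists_polynomial_along_curve {n d : ℕ} {F : MvPolynomial (Fin 3) ℝ}
    (hF : F.totalDegree ≤ n) (x : Fin 3 → ℝ) (A : Matrix (Fin 3) (Fin 3) ℝ) (h : Fin 3 → ℝ[X])
    (hh : ∀ j, (h j).natDegree ≤ d) :
    ∃ p : ℝ[X], p.natDegree ≤ n * d ∧
      ∀ b, p.eval b = MvPolynomial.eval (x + A.mulVec fun j => (h j).eval b) F := by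
  refine ⟨MvPolynomial.aeval (fun i => C (x i) + ∑ j, C (A i j) * h j) F,
    MvPolynomial.aeval_natDegree_le F hF _ fun i => ?_, fun b => ?_⟩
  · refine (natDegree_add_le _ _).trans (max_le (by simp) ?_)
    exact natDegree_sum_le_of_forall_le _ _ fun j _ => (natDegree_C_mul_le _ _).trans (hh j)
  · clear hF
    induction F using MvPolynomial.induction_on with
    | C a => simp
    | add p q hp hq => simp only [map_add, eval_add, hp, hq]
    | mul_X p i hp =>
      simp only [map_mul, eval_mul, hp, MvPolynomial.aeval_X, MvPolynomial.eval_X]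
      simp [Matrix.mulVec, dotProduct, eval_finsetSum]

/-- The model domain, bounded by a parabolic cylinder on which the origin lies. -/
def parabolicPrism : Set (Fin 3 → ℝ) :=
  {y | y 0 ∈ Set.Icc (0 : ℝ) 1 ∧ y 1 ∈ Set.Icc (-1 : ℝ) 1 ∧
    y 2 ∈ Set.Icc (y 1 ^ 2) (2 * y 1 ^ 2)}

theorem measurableSet_parabolicPrism : MeasurableSet parabolicPrism := by
  apply IsClosed.measurableSet
  simp only [parabolicPrism, Set.mem_Icc, Set.ofPred_and]
  repeat' apply IsClosed.inter
  all_goals exact isClosed_le (by fun_prop) (by fun_prop)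

open Polynomial in
theorem sq_eval_le_lintegral_parabolicPrism {n : ℕ} (hn : 1 ≤ n) {F : MvPolynomial (Fin 3) ℝ}
    (hF : F.totalDegree ≤ n) (x : Fin 3 → ℝ) (A : Matrix (Fin 3) (Fin 3) ℝ) :
    ENNReal.ofReal (MvPolynomial.eval x F ^ 2) ≤ ENNReal.ofReal (1728 * n ^ 5) *
      ∫⁻ y in parabolicPrism, ENNReal.ofReal (MvPolynomial.eval (x + A.mulVec y) F ^ 2) := by
  set f : (Fin 3 → ℝ) → ℝ≥0∞ :=
    fun y => ENNReal.ofReal (MvPolynomial.eval (x + A.mulVec y) F ^ 2) with hf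
  have hfc : Continuous f := by
    have hev : Continuous fun z => MvPolynomial.eval z F := MvPolynomial.continuous_eval F
    have hA : Continuous fun y => x + A.mulVec y := by fun_prop
    exact ENNReal.continuous_ofReal.comp ((hev.comp hA).pow 2)
  have step1 : ENNReal.ofReal (MvPolynomial.eval x F ^ 2) ≤
      ENNReal.ofReal (12 * n ^ 2) * ∫⁻ t in Set.Icc (0 : ℝ) 1, f ![t, 0, 0] := by
    obtain ⟨p, hpd, hp⟩ := exists_polynomial_along_curve hF x A ![X, 0, 0] (d := 1) (by
      intro j; fin_cases j <;> simp)
    have h1 := sq_eval_zero_le_integral_Icc hn p (by simpa using hpd)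
    have e : ∀ t, (fun j => (![X, 0, 0] j : ℝ[X]).eval t) = ![t, 0, 0] := by
      intro t; funext j; fin_cases j <;> simp
    have e0 : (![0, 0, 0] : Fin 3 → ℝ) = 0 := by funext j; fin_cases j <;> rfl
    have hx : MvPolynomial.eval x F = p.eval 0 := by rw [hp, e, e0]; simp
    rw [hx]
    refine (ENNReal.ofReal_le_ofReal h1).trans ?_
    rw [ENNReal.ofReal_mul (by positivity), ofReal_intervalIntegral (by norm_num) (by fun_prop)
      (fun _ => sq_nonneg _)]
    simp only [hp, e, hf, le_refl]
  -- For each `κ` the parabola `b ↦ (t, b, κb²)` passes through `(t, 0, 0)`.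
  have step2 : ∀ t κ : ℝ, f ![t, 0, 0] ≤ ENNReal.ofReal (144 * n ^ 3) *
      ∫⁻ b in Set.Icc (-1 : ℝ) 1, f ![t, b, b ^ 2 * κ] * ENNReal.ofReal (b ^ 2) := by
    intro t κ
    obtain ⟨p, hpd, hp⟩ := exists_polynomial_along_curve hF x A ![C t, X, X ^ 2 * C κ] (d := 2) (by
      intro j
      fin_cases j
      · simp
      · simp
      · exact natDegree_mul_C_le _ _ |>.trans (by simp))
    have h1 := sq_eval_zero_le_integral_sq_weight hn p (by omega)
    have e : ∀ b, (fun j => (![C t, X, X ^ 2 * C κ] j : ℝ[X]).eval b) = ![t, b, b ^ 2 * κ] := by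
      intro b; funext j; fin_cases j <;> simp
      ring
    have hx : MvPolynomial.eval (x + A.mulVec ![t, 0, 0]) F = p.eval 0 := by
      rw [hp, e]; simp
    have hx' : f ![t, 0, 0] = ENNReal.ofReal (p.eval 0 ^ 2) := by rw [hf]; simp only [hx]
    rw [hx']
    refine (ENNReal.ofReal_le_ofReal h1).trans ?_
    rw [ENNReal.ofReal_mul (by positivity), ofReal_intervalIntegral (by norm_num) (by fun_prop)
      (fun _ => by positivity)]
    simp only [hp, e, hf, ENNReal.ofReal_mul (sq_nonneg _), le_refl]
  have step3 : ∀ t : ℝ, f ![t, 0, 0] ≤ ENNReal.ofReal (144 * n ^ 3) *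
      ∫⁻ b in Set.Icc (-1 : ℝ) 1, ∫⁻ a in Set.Icc (b ^ 2) (2 * b ^ 2), f ![t, b, a] := by
    intro t
    -- The interval of `κ` has length one, so averaging leaves the left side unchanged, while on the
    -- right the family of parabolas sweeps out a planar slice of the prism.
    have hv : ∫⁻ _κ in Set.Icc (1 : ℝ) 2, f ![t, 0, 0] = f ![t, 0, 0] := by
      norm_num
    have hmeas : Measurable fun z : ℝ × ℝ =>
        f ![t, z.2, z.2 ^ 2 * z.1] * ENNReal.ofReal (z.2 ^ 2) := by
      exact (hfc.comp (by fun_prop)).measurable.mul (by fun_prop)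
    calc f ![t, 0, 0] = ∫⁻ _κ in Set.Icc (1 : ℝ) 2, f ![t, 0, 0] := hv.symm
      _ ≤ ∫⁻ κ in Set.Icc (1 : ℝ) 2, ENNReal.ofReal (144 * n ^ 3) *
          ∫⁻ b in Set.Icc (-1 : ℝ) 1, f ![t, b, b ^ 2 * κ] * ENNReal.ofReal (b ^ 2) :=
        lintegral_mono fun κ => step2 t κ
      _ = ENNReal.ofReal (144 * n ^ 3) * ∫⁻ κ in Set.Icc (1 : ℝ) 2,
          ∫⁻ b in Set.Icc (-1 : ℝ) 1, f ![t, b, b ^ 2 * κ] * ENNReal.ofReal (b ^ 2) :=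
        lintegral_const_mul' _ _ ENNReal.ofReal_ne_top
      _ = ENNReal.ofReal (144 * n ^ 3) * ∫⁻ b in Set.Icc (-1 : ℝ) 1,
          ∫⁻ κ in Set.Icc (1 : ℝ) 2, f ![t, b, b ^ 2 * κ] * ENNReal.ofReal (b ^ 2) := by
        rw [lintegral_lintegral_swap]
        exact hmeas.aemeasurable
      _ ≤ _ := by
        refine mul_le_mul_right (lintegral_mono fun b => ?_) _
        exact lintegral_Icc_one_two_scale_le (g := fun a => f ![t, b, a])
          (hfc.measurable.comp (by fun_prop)) (sq_nonneg b)
  have hS : ∫⁻ t in Set.Icc (0 : ℝ) 1, ∫⁻ b in Set.Icc (-1 : ℝ) 1,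
      ∫⁻ a in Set.Icc (b ^ 2) (2 * b ^ 2), f ![t, b, a] ≤ ∫⁻ y in parabolicPrism, f y := by
    rw [← lintegral_indicator measurableSet_parabolicPrism,
      lintegral_fin_three (hfc.measurable.indicator measurableSet_parabolicPrism),
      ← lintegral_indicator measurableSet_Icc]
    refine lintegral_mono (Set.indicator_le fun t ht => ?_)
    rw [← lintegral_indicator measurableSet_Icc]
    refine lintegral_mono (Set.indicator_le fun b hb => ?_)
    rw [← lintegral_indicator measurableSet_Icc]
    refine lintegral_mono (Set.indicator_le fun a ha => ?_)
    rw [Set.indicator_of_mem (show ![t, b, a] ∈ parabolicPrism from ⟨ht, hb, ha⟩)]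
  refine le_trans ?_ (mul_le_mul_right hS _)
  calc _ ≤ _ := step1
    _ ≤ ENNReal.ofReal (12 * n ^ 2) * ∫⁻ t in Set.Icc (0 : ℝ) 1, ENNReal.ofReal (144 * n ^ 3) *
      ∫⁻ b in Set.Icc (-1 : ℝ) 1, ∫⁻ a in Set.Icc (b ^ 2) (2 * b ^ 2), f ![t, b, a] := by
      gcongr with t
      exact step3 t
    _ = _ := by
      rw [lintegral_const_mul' _ _ ENNReal.ofReal_ne_top, ← mul_assoc,
        ← ENNReal.ofReal_mul (by positivity)]
      congr 2
      ring

/-! ### Affine copies of the prism in the half ball -/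

/-- The half ball in the coordinate space `Fin 3 → ℝ`. -/
def coordHalfBall : Set (Fin 3 → ℝ) :=
  {z | z 0 ^ 2 + z 1 ^ 2 + z 2 ^ 2 ≤ 1 ∧ 0 ≤ z 2}

theorem measurableSet_coordHalfBall : MeasurableSet coordHalfBall := by
  apply IsClosed.measurableSet
  simp only [coordHalfBall, Set.ofPred_and]
  exact (isClosed_le (by fun_prop) (by fun_prop)).inter (isClosed_le (by fun_prop) (by fun_prop))

theorem mem_halfBall3_iff (x : EuclideanSpace ℝ (Fin 3)) :
    x ∈ halfBall3 ↔ WithLp.ofLp x ∈ coordHalfBall := by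
  have : ‖x‖ ≤ 1 ↔ x 0 ^ 2 + x 1 ^ 2 + x 2 ^ 2 ≤ 1 := by
    rw [← sq_le_one_iff₀ (norm_nonneg x), EuclideanSpace.norm_sq_eq]
    simp [Fin.sum_univ_three]
  simp [halfBall3, coordHalfBall, this]

/-- In the vertical plane through `x` and the axis, `t` moves the point towards radial coordinate
`-1/4`, height `1/4`, and `a` towards radial coordinate `-1/4`, height `0`; `b` moves it
tangentially. The tangential step raises the squared norm by `b²/16`, which the inward motion
absorbs because `b² ≤ a`. Aiming beyond the axis keeps the determinant away from `0` even when `x`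
lies on it. -/
theorem exists_affine_parabolicPrism_subset {x : Fin 3 → ℝ} (hx : x ∈ coordHalfBall) :
    ∃ A : Matrix (Fin 3) (Fin 3) ℝ, 1 / 512 ≤ |A.det| ∧
      ∀ y ∈ parabolicPrism, x + A.mulVec y ∈ coordHalfBall := by
  obtain ⟨r, α, β, hr, hαβ, h0, h1⟩ : ∃ r α β : ℝ, 0 ≤ r ∧ α ^ 2 + β ^ 2 = 1 ∧
      x 0 = r * α ∧ x 1 = r * β := by
    -- Polar coordinates through `Complex.arg` give a unit vector `(α, β)` even for `r = 0`.
    refine ⟨‖(⟨x 0, x 1⟩ : ℂ)‖, Real.cos (Complex.arg ⟨x 0, x 1⟩),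
      Real.sin (Complex.arg ⟨x 0, x 1⟩), norm_nonneg _, Real.cos_sq_add_sin_sq _, ?_, ?_⟩
    · rw [Complex.norm_mul_cos_arg]
    · rw [Complex.norm_mul_sin_arg]
  obtain ⟨hx1, hh⟩ := hx
  set h := x 2 with hh2
  have hrh : r ^ 2 + h ^ 2 ≤ 1 := by
    rw [h0, h1] at hx1
    nlinarith
  have hh1 : h ≤ 1 := by nlinarith
  refine ⟨!![-(r + 1 / 4) * α / 2, -β / 4, -(r + 1 / 4) * α / 4;
      -(r + 1 / 4) * β / 2, α / 4, -(r + 1 / 4) * β / 4;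
      (1 / 4 - h) / 2, 0, -h / 4], ?_, ?_⟩
  · rw [Matrix.det_fin_three]
    simp only [Matrix.of_apply, Matrix.cons_val]
    refine le_trans ?_ (le_abs_self _)
    have : ∀ s : ℝ, s = (r + 1 / 4) / 128 * (α ^ 2 + β ^ 2) → 1 / 512 ≤ s := by
      rintro s rfl; rw [hαβ]; linarith
    apply this
    ring
  · rintro y ⟨⟨ht0, ht1⟩, ⟨hb0, hb1⟩, ⟨ha0, ha1⟩⟩
    set t := y 0
    set b := y 1
    set a := y 2
    have hb2 : b ^ 2 ≤ 1 := by nlinarith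
    have hb3 := sq_nonneg b
    simp only [coordHalfBall, Set.mem_ofPred_eq, Pi.add_apply, Matrix.mulVec, dotProduct,
      Fin.sum_univ_three, Matrix.of_apply, Matrix.cons_val, h0, h1, ← hh2]
    change (_ + (_ * t + _ * b + _ * a)) ^ 2 + (_ + (_ * t + _ * b + _ * a)) ^ 2
      + (_ + (_ * t + _ * b + _ * a)) ^ 2 ≤ 1 ∧ 0 ≤ _ + (_ * t + _ * b + _ * a)
    -- `l` is the total fraction of the way travelled inwards: the new radial coordinate is `(1 -
    -- l)r - l/4` and the new height `(1 - l)h + t/8`.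
    obtain ⟨l, hl⟩ : ∃ l, l = t / 2 + a / 4 := ⟨_, rfl⟩
    have hl0 : 0 ≤ l := by linarith
    have hl1 : l ≤ 1 := by linarith
    constructor
    · have key : ∀ s : ℝ, s = (((1 - l) * r - l / 4) ^ 2 + (b / 4) ^ 2) * (α ^ 2 + β ^ 2)
          + ((1 - l) * h + t / 8) ^ 2 → s ≤ 1 := by
        rintro s rfl
        rw [hαβ, mul_one]
        have e1 : 0 ≤ (1 - l) * l * r := by
          have := sub_nonneg.2 hl1; positivity
        have e2 : (1 - l) * h * t ≤ (1 - l) * 1 * (2 * l) := by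
          have := sub_nonneg.2 hl1
          gcongr
          linarith
        have e3 : (1 - l) ^ 2 * (r ^ 2 + h ^ 2) ≤ (1 - l) ^ 2 * 1 := by gcongr
        have e4 : t ^ 2 ≤ (2 * l) ^ 2 := by gcongr; linarith
        have e5 : b ^ 2 ≤ 4 * l := by linarith
        nlinarith
      apply key
      rw [hl]
      ring
    · have : ∀ s : ℝ, s = (1 - l) * h + t / 8 → 0 ≤ s := by
        rintro s rfl
        have := sub_nonneg.2 hl1
        positivity
      apply this
      rw [hl]
      ring

theorem sq_eval_le_lintegral_coordHalfBall {n : ℕ} (hn : 1 ≤ n) {F : MvPolynomial (Fin 3) ℝ}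
    (hF : F.totalDegree ≤ n) {x : Fin 3 → ℝ} (hx : x ∈ coordHalfBall) :
    ENNReal.ofReal (MvPolynomial.eval x F ^ 2) ≤ ENNReal.ofReal (884736 * n ^ 5) *
      ∫⁻ z in coordHalfBall, ENNReal.ofReal (MvPolynomial.eval z F ^ 2) := by
  obtain ⟨A, hA, hsub⟩ := exists_affine_parabolicPrism_subset hx
  have hdet : A.det ≠ 0 := by
    intro h; rw [h] at hA; norm_num at hA
  set g : (Fin 3 → ℝ) → ℝ≥0∞ := coordHalfBall.indicator
    fun z => ENNReal.ofReal (MvPolynomial.eval z F ^ 2) with hg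
  have hgm : Measurable g := by
    refine Measurable.indicator ?_ measurableSet_coordHalfBall
    exact (ENNReal.continuous_ofReal.comp
      ((MvPolynomial.continuous_eval F).pow 2)).measurable
  refine (sq_eval_le_lintegral_parabolicPrism hn hF x A).trans ?_
  have h1 : ∫⁻ y in parabolicPrism, ENNReal.ofReal (MvPolynomial.eval (x + A.mulVec y) F ^ 2)
      ≤ ENNReal.ofReal 512 * ∫⁻ z, g z := by
    calc _ ≤ ∫⁻ y, g (x + A.mulVec y) := by
          rw [← lintegral_indicator measurableSet_parabolicPrism]
          refine lintegral_mono (Set.indicator_le fun y hy => ?_)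
          rw [hg, Set.indicator_of_mem (hsub y hy)]
      _ = ∫⁻ z, g (x + z) ∂(Measure.map (Matrix.toLin' A) volume) := by
          rw [lintegral_map (f := fun z => g (x + z)) (hgm.comp (measurable_const_add x))
            (LinearMap.continuous_of_finiteDimensional _).measurable]
          rfl
      -- The linear change of variables costs `|det A|⁻¹ ≤ 512`, and the translation by `x` costs
      -- nothing.
      _ ≤ _ := by
          rw [Real.map_matrix_volume_pi_eq_smul_volume_pi hdet, lintegral_smul_measure,
            lintegral_add_left_eq_self, smul_eq_mul]
          gcongr
          rw [abs_inv]
          exact inv_le_of_inv_le₀ (by norm_num) (by linarith)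
  calc _ ≤ ENNReal.ofReal (1728 * n ^ 5) * (ENNReal.ofReal 512 * ∫⁻ z, g z) := by gcongr
    _ = _ := by
      rw [← mul_assoc, ← ENNReal.ofReal_mul (by positivity), hg,
        lintegral_indicator measurableSet_coordHalfBall]
      congr 2; ring

theorem exists_mvPolynomial_of_mem_polySpace {d n : ℕ} {φ : EuclideanSpace ℝ (Fin d) → ℝ}
    (hφ : φ ∈ polySpace d n) : ∃ F : MvPolynomial (Fin d) ℝ, F.totalDegree ≤ n ∧
      ∀ x, φ x = MvPolynomial.eval (WithLp.ofLp x) F := by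
  obtain ⟨F, hF, rfl⟩ := hφ
  exact ⟨F, (MvPolynomial.mem_restrictTotalDegree _ _ _).1 hF, fun x => rfl⟩

theorem continuous_of_mem_polySpace {d n : ℕ} {φ : EuclideanSpace ℝ (Fin d) → ℝ}
    (hφ : φ ∈ polySpace d n) : Continuous φ := by
  obtain ⟨F, -, hF⟩ := exists_mvPolynomial_of_mem_polySpace hφ
  rw [funext hF]
  exact (MvPolynomial.continuous_eval F).comp (PiLp.continuous_ofLp 2 _)

theorem lintegral_halfBall3 (f : (Fin 3 → ℝ) → ℝ≥0∞) :
    ∫⁻ x in halfBall3, f (WithLp.ofLp x) = ∫⁻ z in coordHalfBall, f z := by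
  have hp := PiLp.volume_preserving_ofLp (Fin 3)
  have hB : halfBall3 = WithLp.ofLp ⁻¹' coordHalfBall := Set.ext mem_halfBall3_iff
  rw [hB]
  exact hp.setLIntegral_comp_preimage_emb
    (MeasurableEquiv.toLp 2 (Fin 3 → ℝ)).symm.measurableEmbedding f coordHalfBall

theorem sq_le_lintegral_halfBall3 {n : ℕ} (hn : 1 ≤ n) {φ : EuclideanSpace ℝ (Fin 3) → ℝ}
    (hφ : φ ∈ polySpace 3 n) {x : EuclideanSpace ℝ (Fin 3)} (hx : x ∈ halfBall3) :
    ENNReal.ofReal (φ x ^ 2) ≤ ENNReal.ofReal (884736 * n ^ 5) *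
      ∫⁻ z in halfBall3, ENNReal.ofReal (φ z ^ 2) := by
  obtain ⟨F, hFd, hF⟩ := exists_mvPolynomial_of_mem_polySpace hφ
  simp only [hF]
  rw [lintegral_halfBall3 fun z => ENNReal.ofReal (MvPolynomial.eval z F ^ 2)]
  exact sq_eval_le_lintegral_coordHalfBall hn hFd ((mem_halfBall3_iff x).1 hx)

/-! ### Polynomials peaking at the edge -/

open Polynomial in
theorem abs_eval_U_le (m : ℕ) {x : ℝ} (hx : |x| ≤ 1) : |(Chebyshev.U ℝ m).eval x| ≤ m + 1 := by
  induction m with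
  | zero => simp
  | succ m ih =>
    push_cast
    rw [Chebyshev.U_eq_X_mul_U_add_T, eval_add, eval_mul, eval_X]
    have hT := Chebyshev.abs_eval_T_real_le_one (m + 1) hx
    calc _ ≤ |x * (Chebyshev.U ℝ m).eval x| + |(Chebyshev.T ℝ (m + 1)).eval x| := abs_add_le _ _
      _ ≤ 1 * (m + 1) + 1 := by
        rw [abs_mul]
        gcongr
      _ = _ := by ring

open Polynomial in
theorem sq_eval_U_mul_le_one (m : ℕ) {x : ℝ} (hx : |x| ≤ 1) :
    (Chebyshev.U ℝ m).eval x ^ 2 * (1 - x ^ 2) ≤ 1 := by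
  obtain ⟨h1, h2⟩ := abs_le.1 hx
  have hc := Real.cos_arccos h1 h2
  have h := Chebyshev.U_real_cos (Real.arccos x) m
  rw [hc] at h
  calc _ = (eval x (Chebyshev.U ℝ m) * Real.sin (Real.arccos x)) ^ 2 := by
        rw [mul_pow, Real.sin_sq, hc]
    _ ≤ 1 := by rw [h]; exact Real.sin_sq_le_one _

-- The bounds `|U_m| ≤ m + 1` and `U_m² (1 - x²) ≤ 1` are merged into one integrable majorant with
-- explicit antiderivatives near each endpoint.
open Polynomial in
theorem eval_U_pow_four_le (m : ℕ) {x : ℝ} (hx : |x| ≤ 1) :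
    (Chebyshev.U ℝ m).eval x ^ 4 ≤ 4 / (1 / ((m : ℝ) + 1) ^ 2 + (1 - x ^ 2)) ^ 2 := by
  have hy : 0 ≤ 1 - x ^ 2 := by nlinarith [sq_abs x, abs_nonneg x]
  rw [le_div_iff₀ (by positivity)]
  have h1 : (Chebyshev.U ℝ m).eval x ^ 2 * (1 / ((m : ℝ) + 1) ^ 2) ≤ 1 := by
    rw [mul_one_div, div_le_one (by positivity)]
    exact sq_le_sq' (by linarith [(abs_le.1 (abs_eval_U_le m hx)).1])
      (abs_le.1 (abs_eval_U_le m hx)).2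
  have h2 := sq_eval_U_mul_le_one m hx
  calc _ = ((Chebyshev.U ℝ m).eval x ^ 2 * (1 / ((m : ℝ) + 1) ^ 2)
        + (Chebyshev.U ℝ m).eval x ^ 2 * (1 - x ^ 2)) ^ 2 := by ring
    _ ≤ (1 + 1) ^ 2 := by gcongr
    _ = 4 := by norm_num

theorem lintegral_Icc_eq_of_hasDerivAt {a b : ℝ} (hab : a ≤ b) {f f' : ℝ → ℝ}
    (hd : ∀ x ∈ Set.Icc a b, HasDerivAt f (f' x) x) (hc : ContinuousOn f' (Set.Icc a b))
    (h0 : ∀ x ∈ Set.Icc a b, 0 ≤ f' x) :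
    ∫⁻ x in Set.Icc a b, ENNReal.ofReal (f' x) = ENNReal.ofReal (f b - f a) := by
  rw [← ofReal_integral_eq_lintegral_ofReal hc.integrableOn_Icc
    ((ae_restrict_iff' measurableSet_Icc).2 (Filter.Eventually.of_forall h0)),
    integral_Icc_eq_integral_Ioc, ← intervalIntegral.integral_of_le hab,
    intervalIntegral.integral_eq_sub_of_hasDerivAt (by rwa [Set.uIcc_of_le hab])]
  exact (by rwa [Set.uIcc_of_le hab] : ContinuousOn f' (Set.uIcc a b)).intervalIntegrable

open Polynomial in
theorem lintegral_U_pow_four_le (m : ℕ) :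
    ∫⁻ t in Set.Icc (0 : ℝ) 1, ENNReal.ofReal ((Chebyshev.U ℝ m).eval (1 - 2 * t) ^ 4)
      ≤ ENNReal.ofReal (4 * ((m : ℝ) + 1) ^ 2) := by
  obtain ⟨δ, hδ⟩ : ∃ δ : ℝ, δ = 1 / ((m : ℝ) + 1) ^ 2 := ⟨_, rfl⟩
  have hδ0 : 0 < δ := by rw [hδ]; positivity
  have hp1 : ∀ t ∈ Set.Icc (0 : ℝ) 1, 0 < δ + 2 * t := fun t ht => by linarith [ht.1]
  have hp2 : ∀ t ∈ Set.Icc (0 : ℝ) 1, 0 < δ + 2 * (1 - t) := fun t ht => by linarith [ht.2]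
  have key := lintegral_Icc_eq_of_hasDerivAt (a := 0) (b := 1) zero_le_one
    (f := fun t => 2 * (δ + 2 * (1 - t))⁻¹ - 2 * (δ + 2 * t)⁻¹)
    (f' := fun t => 4 / (δ + 2 * (1 - t)) ^ 2 + 4 / (δ + 2 * t) ^ 2)
    (fun t ht => by
      have d1 : HasDerivAt (fun t : ℝ => δ + 2 * (1 - t)) (2 * (-1)) t :=
        (((hasDerivAt_id t).const_sub 1).const_mul 2).const_add δ
      have d2 : HasDerivAt (fun t : ℝ => δ + 2 * t) (2 * 1) t :=
        ((hasDerivAt_id t).const_mul 2).const_add δ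
      have := ((d1.inv (hp2 t ht).ne').const_mul 2).sub ((d2.inv (hp1 t ht).ne').const_mul 2)
      convert! this using 1
      ring)
    (by
      refine ContinuousOn.add (ContinuousOn.div (by fun_prop) (by fun_prop) fun t ht => ?_)
        (ContinuousOn.div (by fun_prop) (by fun_prop) fun t ht => ?_)
      · exact pow_ne_zero _ (hp2 t ht).ne'
      · exact pow_ne_zero _ (hp1 t ht).ne')
    (fun t _ => by positivity)
  calc _ ≤ ∫⁻ t in Set.Icc (0 : ℝ) 1,
        ENNReal.ofReal (4 / (δ + 2 * (1 - t)) ^ 2 + 4 / (δ + 2 * t) ^ 2) := by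
        refine setLIntegral_mono' measurableSet_Icc fun t ht => ENNReal.ofReal_le_ofReal ?_
        have hx : |1 - 2 * t| ≤ 1 := abs_le.2 ⟨by linarith [ht.2], by linarith [ht.1]⟩
        refine (eval_U_pow_four_le m hx).trans ?_
        rw [← hδ]
        have h1 := hp1 t ht
        have h2 := hp2 t ht
        -- Here `1 - (1 - 2t)² = 4t(1 - t)` is at least `2t` on the left half and at least `2(1 -
        -- t)` on the right half.
        rcases le_total t (1 / 2) with h | h
        · refine le_trans ?_ (le_add_of_nonneg_left (by positivity))
          gcongr
          nlinarith [ht.1]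
        · refine le_trans ?_ (le_add_of_nonneg_right (by positivity))
          gcongr
          nlinarith [ht.2]
    _ = _ := key
    _ ≤ _ := by
      refine ENNReal.ofReal_le_ofReal ?_
      have : δ⁻¹ = ((m : ℝ) + 1) ^ 2 := by rw [hδ]; simp
      have h3 : 0 ≤ (δ + 2)⁻¹ := by positivity
      norm_num
      linarith

open Polynomial in
theorem lintegral_U_pow_four_mul_sqrt_le (m : ℕ) :
    ∫⁻ x in Set.Icc (-1 : ℝ) 1, ENNReal.ofReal ((Chebyshev.U ℝ m).eval x ^ 4) *
      ENNReal.ofReal (2 * √(1 - x ^ 2)) ≤ ENNReal.ofReal (32 * ((m : ℝ) + 1)) := by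
  obtain ⟨δ, hδ⟩ : ∃ δ : ℝ, δ = 1 / ((m : ℝ) + 1) ^ 2 := ⟨_, rfl⟩
  have hδ0 : 0 < δ := by rw [hδ]; positivity
  have hp1 : ∀ t ∈ Set.Icc (-1 : ℝ) 1, 0 < δ + (1 + t) := fun t ht => by linarith [ht.1]
  have hp2 : ∀ t ∈ Set.Icc (-1 : ℝ) 1, 0 < δ + (1 - t) := fun t ht => by linarith [ht.2]
  have key := lintegral_Icc_eq_of_hasDerivAt (a := -1) (b := 1) (by norm_num)
    (f := fun t => 16 * (√(δ + (1 - t)))⁻¹ - 16 * (√(δ + (1 + t)))⁻¹)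
    (f' := fun t => 8 / √(δ + (1 - t)) ^ 3 + 8 / √(δ + (1 + t)) ^ 3)
    (fun t ht => by
      have d1 : HasDerivAt (fun t : ℝ => δ + (1 - t)) (-1) t :=
        ((hasDerivAt_id t).const_sub 1).const_add δ
      have d2 : HasDerivAt (fun t : ℝ => δ + (1 + t)) 1 t :=
        ((hasDerivAt_id t).const_add 1).const_add δ
      have s1 := Real.sqrt_pos.2 (hp1 t ht)
      have s2 := Real.sqrt_pos.2 (hp2 t ht)
      have := (((d1.sqrt (hp2 t ht).ne').inv s2.ne').const_mul 16).sub
        (((d2.sqrt (hp1 t ht).ne').inv s1.ne').const_mul 16)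
      convert! this using 1
      field_simp
      ring)
    (by
      refine ContinuousOn.add (ContinuousOn.div (by fun_prop) (by fun_prop) fun t ht => ?_)
        (ContinuousOn.div (by fun_prop) (by fun_prop) fun t ht => ?_)
      · exact pow_ne_zero _ (Real.sqrt_pos.2 (hp2 t ht)).ne'
      · exact pow_ne_zero _ (Real.sqrt_pos.2 (hp1 t ht)).ne')
    (fun t _ => by positivity)
  calc _ ≤ ∫⁻ t in Set.Icc (-1 : ℝ) 1,
        ENNReal.ofReal (8 / √(δ + (1 - t)) ^ 3 + 8 / √(δ + (1 + t)) ^ 3) := by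
        refine setLIntegral_mono' measurableSet_Icc fun t ht => ?_
        rw [← ENNReal.ofReal_mul (by positivity)]
        refine ENNReal.ofReal_le_ofReal ?_
        have hx : |t| ≤ 1 := abs_le.2 ht
        have hy : 0 ≤ 1 - t ^ 2 := by nlinarith [ht.1, ht.2]
        have h1 := hp1 t ht
        have h2 := hp2 t ht
        have hz : 0 < δ + (1 - t ^ 2) := by linarith
        have hsq := Real.sq_sqrt hz.le
        have hsp := Real.sqrt_pos.2 hz
        have h3 : (Chebyshev.U ℝ m).eval t ^ 4 * (2 * √(1 - t ^ 2))
            ≤ 8 / √(δ + (1 - t ^ 2)) ^ 3 := by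
          calc _ ≤ 4 / (δ + (1 - t ^ 2)) ^ 2 * (2 * √(δ + (1 - t ^ 2))) := by
                gcongr
                · rw [hδ]; exact eval_U_pow_four_le m hx
                · linarith
            _ = 4 / (√(δ + (1 - t ^ 2)) ^ 2) ^ 2 * (2 * √(δ + (1 - t ^ 2))) := by rw [hsq]
            _ = _ := by field_simp; norm_num
        refine h3.trans ?_
        have s1 := Real.sqrt_pos.2 h1
        have s2 := Real.sqrt_pos.2 h2
        -- On each half, `1 - t²` is at least the distance to the nearer endpoint.
        rcases le_total t 0 with h | h
        · refine le_trans ?_ (le_add_of_nonneg_left (by positivity))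
          gcongr
          nlinarith [ht.1]
        · refine le_trans ?_ (le_add_of_nonneg_right (by positivity))
          gcongr
          nlinarith [ht.2]
    _ = _ := key
    _ ≤ _ := by
      refine ENNReal.ofReal_le_ofReal ?_
      have : (√δ)⁻¹ = (m : ℝ) + 1 := by
        rw [hδ, Real.sqrt_div zero_le_one, Real.sqrt_one, Real.sqrt_sq (by positivity)]; simp
      have h3 : 0 ≤ (√(δ + 2))⁻¹ := by positivity
      norm_num
      linarith

theorem totalDegree_aeval_le {σ : Type*} (p : Polynomial ℝ) {q : MvPolynomial σ ℝ}
    (hq : q.totalDegree ≤ 1) : (Polynomial.aeval q p).totalDegree ≤ p.natDegree := by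
  rw [Polynomial.aeval_eq_sum_range]
  refine MvPolynomial.totalDegree_finsetSum_le fun k hk => ?_
  refine (MvPolynomial.totalDegree_smul_le _ _).trans ((MvPolynomial.totalDegree_pow _ _).trans ?_)
  have := Finset.mem_range.1 hk
  nlinarith

-- Enlarging the range of the third coordinate to `[0, 1]` makes the integral a product; only the
-- width `2√(1 - a²)` of the second coordinate is kept.
open Polynomial in
theorem lintegral_coordHalfBall_U_le (m : ℕ) :
    ∫⁻ z in coordHalfBall, ENNReal.ofReal (((Chebyshev.U ℝ m).eval (z 0) ^ 2 *
      (Chebyshev.U ℝ m).eval (1 - 2 * z 2) ^ 2) ^ 2) ≤ ENNReal.ofReal (128 * ((m : ℝ) + 1) ^ 3) := by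
  have hm : Measurable (coordHalfBall.indicator fun z => ENNReal.ofReal
      (((Chebyshev.U ℝ m).eval (z 0) ^ 2 * (Chebyshev.U ℝ m).eval (1 - 2 * z 2) ^ 2) ^ 2)) := by
    refine Measurable.indicator (Continuous.measurable ?_) measurableSet_coordHalfBall
    exact ENNReal.continuous_ofReal.comp (by fun_prop)
  rw [← lintegral_indicator measurableSet_coordHalfBall, lintegral_fin_three hm]
  calc _ ≤ ∫⁻ a in Set.Icc (-1 : ℝ) 1, ∫⁻ b in Set.Icc (-√(1 - a ^ 2)) (√(1 - a ^ 2)),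
        ∫⁻ c in Set.Icc (0 : ℝ) 1, ENNReal.ofReal ((Chebyshev.U ℝ m).eval a ^ 4) *
          ENNReal.ofReal ((Chebyshev.U ℝ m).eval (1 - 2 * c) ^ 4) := by
        rw [← lintegral_indicator measurableSet_Icc]
        refine lintegral_mono fun a => ?_
        have hz : ∀ b c : ℝ, (![a, b, c] : Fin 3 → ℝ) ∈ coordHalfBall →
          a ^ 2 + b ^ 2 + c ^ 2 ≤ 1 ∧ 0 ≤ c := fun b c h => h
        by_cases ha : a ∈ Set.Icc (-1 : ℝ) 1
        · rw [Set.indicator_of_mem ha, ← lintegral_indicator measurableSet_Icc]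
          refine lintegral_mono fun b => ?_
          by_cases hb : b ∈ Set.Icc (-√(1 - a ^ 2)) (√(1 - a ^ 2))
          · rw [Set.indicator_of_mem hb, ← lintegral_indicator measurableSet_Icc]
            refine lintegral_mono fun c => ?_
            by_cases h : (![a, b, c] : Fin 3 → ℝ) ∈ coordHalfBall
            swap
            · rw [Set.indicator_of_notMem h]
              exact zero_le
            rw [Set.indicator_of_mem h]
            obtain ⟨h1, h2⟩ := hz b c h
            rw [Set.indicator_of_mem (show c ∈ Set.Icc (0 : ℝ) 1 from ⟨h2, by nlinarith⟩),
              ← ENNReal.ofReal_mul (by positivity)]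
            refine ENNReal.ofReal_le_ofReal (le_of_eq ?_)
            simp only [Matrix.cons_val]
            ring
          · rw [Set.indicator_of_notMem hb, nonpos_iff_eq_zero]
            refine (lintegral_congr fun c => ?_).trans lintegral_zero
            refine Set.indicator_of_notMem (fun h => hb ?_) _
            obtain ⟨h1, h2⟩ := hz b c h
            exact Set.mem_Icc.2 (abs_le.1 (Real.abs_le_sqrt (by nlinarith)))
        · rw [Set.indicator_of_notMem ha, nonpos_iff_eq_zero]
          refine (lintegral_congr fun b => (lintegral_congr fun c => ?_).trans
            lintegral_zero).trans lintegral_zero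
          refine Set.indicator_of_notMem (fun h => ha ?_) _
          obtain ⟨h1, h2⟩ := hz b c h
          exact Set.mem_Icc.2 (abs_le.1 (abs_le_one_iff_mul_self_le_one.2 (by nlinarith)))
    _ = (∫⁻ a in Set.Icc (-1 : ℝ) 1, ENNReal.ofReal ((Chebyshev.U ℝ m).eval a ^ 4) *
          ENNReal.ofReal (2 * √(1 - a ^ 2))) *
        ∫⁻ c in Set.Icc (0 : ℝ) 1, ENNReal.ofReal ((Chebyshev.U ℝ m).eval (1 - 2 * c) ^ 4) := by
        rw [← lintegral_mul_const _ (by fun_prop)]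
        refine lintegral_congr fun a => ?_
        rw [lintegral_const_mul' _ _ ENNReal.ofReal_ne_top, setLIntegral_const, Real.volume_Icc]
        rw [show √(1 - a ^ 2) - -√(1 - a ^ 2) = 2 * √(1 - a ^ 2) by ring]
        ring
    _ ≤ ENNReal.ofReal (32 * ((m : ℝ) + 1)) * ENNReal.ofReal (4 * ((m : ℝ) + 1) ^ 2) :=
        mul_le_mul' (lintegral_U_pow_four_mul_sqrt_le m) (lintegral_U_pow_four_le m)
    _ = _ := by
        rw [← ENNReal.ofReal_mul (by positivity)]
        congr 1; ring

/-- The point on the edge of the half ball at which the extremal polynomials peak. -/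
noncomputable def edgePoint : EuclideanSpace ℝ (Fin 3) := !₂[1, 0, 0]

theorem edgePoint_mem : edgePoint ∈ halfBall3 := by
  rw [mem_halfBall3_iff]
  simp [edgePoint, coordHalfBall]

open Polynomial in
theorem exists_peaking_polynomial (n : ℕ) : ∃ φ ∈ polySpace 3 n, 0 < φ edgePoint ∧
    ENNReal.ofReal (1 / 131072 * n ^ 5) * ∫⁻ z in halfBall3, ENNReal.ofReal (φ z ^ 2)
      ≤ ENNReal.ofReal (φ edgePoint ^ 2) := by
  -- Two squares of polynomials of degree `m` have total degree `4m ≤ n`. The squares make the decay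
  -- of `U_m` away from the endpoints fast enough to avoid a loss in the power of `n`.
  set m := n / 4 with hm
  set F : MvPolynomial (Fin 3) ℝ := (aeval (MvPolynomial.X 0) (Chebyshev.U ℝ m)) ^ 2 *
    (aeval (1 - 2 * MvPolynomial.X 2 : MvPolynomial (Fin 3) ℝ) (Chebyshev.U ℝ m)) ^ 2 with hF
  have hFe : ∀ z, MvPolynomial.eval z F = (Chebyshev.U ℝ m).eval (z 0) ^ 2 *
      (Chebyshev.U ℝ m).eval (1 - 2 * z 2) ^ 2 := by
    have aux : ∀ (z : Fin 3 → ℝ) (q : MvPolynomial (Fin 3) ℝ),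
        MvPolynomial.eval z (aeval q (Chebyshev.U ℝ m))
          = (Chebyshev.U ℝ m).eval (MvPolynomial.eval z q) := by
      intro z q
      rw [← MvPolynomial.coe_aeval_eq_eval]
      exact (Polynomial.aeval_algHom_apply (MvPolynomial.aeval z) q _).symm
    intro z
    simp only [hF, map_mul, map_pow, aux]
    simp
  have hd : (Chebyshev.U ℝ m).natDegree = m := Chebyshev.natDegree_U_natCast ℝ m
  have hq : (1 - 2 * MvPolynomial.X 2 : MvPolynomial (Fin 3) ℝ).totalDegree ≤ 1 := by
    refine (MvPolynomial.totalDegree_sub _ _).trans (max_le (by simp) ?_)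
    rw [show (2 : MvPolynomial (Fin 3) ℝ) = MvPolynomial.C 2 from
      (map_ofNat MvPolynomial.C 2).symm]
    refine (MvPolynomial.totalDegree_mul _ _).trans (by simp)
  have hFd : F.totalDegree ≤ n := by
    have h1 := totalDegree_aeval_le (Chebyshev.U ℝ m)
      (MvPolynomial.totalDegree_X (R := ℝ) (0 : Fin 3)).le
    have h2 := totalDegree_aeval_le (Chebyshev.U ℝ m) hq
    rw [hd] at h1 h2
    refine (MvPolynomial.totalDegree_mul _ _).trans ?_
    have h3 := MvPolynomial.totalDegree_pow
      (aeval (MvPolynomial.X 0 : MvPolynomial (Fin 3) ℝ) (Chebyshev.U ℝ m)) 2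
    have h4 := MvPolynomial.totalDegree_pow
      (aeval (1 - 2 * MvPolynomial.X 2 : MvPolynomial (Fin 3) ℝ) (Chebyshev.U ℝ m)) 2
    omega
  have hval : polyFun 3 F edgePoint = ((m : ℝ) + 1) ^ 4 := by
    change MvPolynomial.eval (WithLp.ofLp edgePoint) F = _
    rw [hFe]
    simp [edgePoint]
    ring
  refine ⟨polyFun 3 F, ⟨F, (MvPolynomial.mem_restrictTotalDegree _ _ _).2 hFd, rfl⟩, ?_, ?_⟩
  · rw [hval]; positivity
  · have hI : ∫⁻ z in halfBall3, ENNReal.ofReal (polyFun 3 F z ^ 2)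
        ≤ ENNReal.ofReal (128 * ((m : ℝ) + 1) ^ 3) := by
      refine le_trans (le_of_eq ?_) (lintegral_coordHalfBall_U_le m)
      rw [← lintegral_halfBall3]
      refine lintegral_congr fun z => ?_
      rw [← hFe]; rfl
    refine (mul_le_mul_right hI _).trans ?_
    rw [hval, ← ENNReal.ofReal_mul (by positivity)]
    refine ENNReal.ofReal_le_ofReal ?_
    -- The constant is `131072 = 4⁵ · 128`.
    have hn : (n : ℝ) ≤ 4 * (m + 1) := by
      have : n ≤ 4 * (m + 1) := by omega
      exact_mod_cast this
    calc 1 / 131072 * (n : ℝ) ^ 5 * (128 * (m + 1) ^ 3)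
        ≤ 1 / 131072 * (4 * (m + 1)) ^ 5 * (128 * ((m : ℝ) + 1) ^ 3) := by gcongr
      _ = _ := by ring

/-! ### Christoffel functions and point evaluation -/

section Christoffel

variable {α : Type*} [MeasurableSpace α] {S : Submodule ℝ (α → ℝ)} {D : Set α} {μ : Measure α}

theorem exists_isOrthonormalBasisOn [Module.Finite ℝ S]
    (hL : ∀ f ∈ S, MemLp f 2 (μ.restrict D))
    (hdef : ∀ f ∈ S, ∫ x in D, f x * f x ∂μ = 0 → f = 0) :
    ∃ (N : ℕ) (φ : Fin N → α → ℝ), IsOrthonormalBasisOn S D μ φ := by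
  have hint : ∀ f g : S, Integrable (fun x => f.1 x * g.1 x) (μ.restrict D) := fun f g =>
    (hL f.1 f.2).integrable_mul (hL g.1 g.2)
  let core : InnerProductSpace.Core ℝ S :=
    { inner := fun f g => ∫ x in D, f.1 x * g.1 x ∂μ
      conj_inner_symm := fun f g => by simp [mul_comm]
      re_inner_nonneg := fun f => by
        simpa using integral_nonneg fun x => mul_self_nonneg (f.1 x)
      add_left := fun f g h => by
        simp only [Submodule.coe_add, Pi.add_apply, add_mul]
        exact integral_add (hint f h) (hint g h)
      smul_left := fun f g r => by
        simp only [Submodule.coe_smul, Pi.smul_apply, smul_eq_mul, mul_assoc]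
        exact integral_const_mul r _
      definite := fun f hf => Subtype.ext (hdef f.1 f.2 hf) }
  let _ : NormedAddCommGroup S := core.toNormedAddCommGroup
  let _ : InnerProductSpace ℝ S := InnerProductSpace.ofCore core.toCore
  let b := stdOrthonormalBasis ℝ S
  refine ⟨_, fun k => (b k).1, fun k => hL _ (b k).2, fun k l => ?_, ?_⟩
  · exact (orthonormal_iff_ite.1 b.orthonormal) k l
  · have hspan : Submodule.span ℝ (Set.range b) = ⊤ := by
      simpa using b.toBasis.span_eq
    have := congrArg (Submodule.map S.subtype) hspan
    rw [Submodule.map_span, Submodule.map_subtype_top, ← Set.range_comp] at this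
    exact this

variable {N : ℕ} {φ : Fin N → α → ℝ}

theorem IsOrthonormalBasisOn.integral_mul_self (h : IsOrthonormalBasisOn S D μ φ) {f : α → ℝ}
    (hf : f ∈ S) : ∫ x in D, f x * f x ∂μ = ∑ k, (∫ x in D, f x * φ k x ∂μ) ^ 2 := by
  have hfL : MemLp f 2 (μ.restrict D) := by
    rw [funext (h.expand hf)]
    exact memLp_finsetSum _ fun k _ => (h.memLp k).const_mul _
  have e : ∀ x, f x * f x = ∑ k, (∫ y in D, f y * φ k y ∂μ) * (f x * φ k x) := by
    intro x
    nth_rw 2 [h.expand hf x]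
    rw [Finset.mul_sum]
    exact Finset.sum_congr rfl fun k _ => by ring
  simp_rw [e]
  rw [integral_finsetSum]
  swap
  · exact fun k _ => (hfL.integrable_mul (h.memLp k)).const_mul _
  simp only [integral_const_mul, sq]

/-- Cauchy–Schwarz for the expansion of `f` at `x`. -/
theorem IsOrthonormalBasisOn.sq_le_christoffelC (h : IsOrthonormalBasisOn S D μ φ) {f : α → ℝ}
    (hf : f ∈ S) (x : α) : f x ^ 2 ≤ (∫ y in D, f y * f y ∂μ) * christoffelC S D μ x := by
  rw [christoffelC_eq h, h.integral_mul_self hf]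
  conv_lhs => rw [h.expand hf x]
  exact Finset.sum_mul_sq_le_sq_mul_sq _ _ _

/-- The hypothesis is tested on the reproducing kernel `∑ φ_k(x) φ_k`, whose value at `x` and whose
squared norm both equal `C`; hence `C² ≤ K C`. -/
theorem IsOrthonormalBasisOn.christoffelC_le (h : IsOrthonormalBasisOn S D μ φ) {x : α} {K : ℝ}
    (hK0 : 0 ≤ K) (hK : ∀ f ∈ S, f x ^ 2 ≤ K * ∫ y in D, f y * f y ∂μ) : christoffelC S D μ x ≤ K := by
  have mφ : ∀ k, φ k ∈ S := fun k => h.span_eq ▸ Submodule.subset_span ⟨k, rfl⟩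
  rw [christoffelC_eq h]
  set C := ∑ k, φ k x ^ 2 with hC
  have hψ : ∑ k, φ k x • φ k ∈ S := Submodule.sum_mem _ fun k _ => S.smul_mem _ (mφ k)
  have hcoef : ∀ k, ∫ y in D, (∑ i, φ i x • φ i) y * φ k y ∂μ = φ k x := by
    intro k
    have h1 : ∀ y, (∑ i, φ i x • φ i) y * φ k y = ∑ i, φ i x * (φ i y * φ k y) := by
      intro y
      simp [Finset.sum_apply, Finset.sum_mul, mul_assoc]
    simp only [h1]
    rw [integral_finsetSum]
    swap
    · exact fun i _ => ((h.memLp i).integrable_mul (h.memLp k)).const_mul _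
    simp [integral_const_mul, h.orthonormal]
  have hint := h.integral_mul_self hψ
  simp only [hcoef, ← hC] at hint
  have hx : (∑ k, φ k x • φ k) x = C := by simp [hC, Finset.sum_apply, sq]
  have key := hK _ hψ
  rw [hint, hx] at key
  have hC0 : 0 ≤ C := Finset.sum_nonneg fun k _ => sq_nonneg _
  rcases hC0.eq_or_lt with h0 | h0
  · rwa [← h0]
  · nlinarith

end Christoffel

/-! ### Christoffel bounds on the half ball -/

theorem isCompact_halfBall3 : IsCompact halfBall3 := by
  refine (isCompact_closedBall (0 : EuclideanSpace ℝ (Fin 3)) 1).of_isClosed_subset ?_ ?_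
  · simp only [halfBall3, Set.ofPred_and]
    exact (isClosed_le (by fun_prop) (by fun_prop)).inter (isClosed_le (by fun_prop) (by fun_prop))
  · exact fun x hx => by simpa using hx.1

theorem integrable_sq_of_mem_polySpace {n : ℕ} {φ : EuclideanSpace ℝ (Fin 3) → ℝ}
    (hφ : φ ∈ polySpace 3 n) : Integrable (fun x => φ x ^ 2) (volume.restrict halfBall3) :=
  ((continuous_of_mem_polySpace hφ).pow 2).continuousOn.integrableOn_compact isCompact_halfBall3

theorem memLp_of_mem_polySpace {n : ℕ} {φ : EuclideanSpace ℝ (Fin 3) → ℝ}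
    (hφ : φ ∈ polySpace 3 n) : MemLp φ 2 (volume.restrict halfBall3) :=
  (memLp_two_iff_integrable_sq (continuous_of_mem_polySpace hφ).aestronglyMeasurable).2
    (integrable_sq_of_mem_polySpace hφ)

theorem ofReal_integral_mul_self {n : ℕ} {φ : EuclideanSpace ℝ (Fin 3) → ℝ}
    (hφ : φ ∈ polySpace 3 n) : ENNReal.ofReal (∫ x in halfBall3, φ x * φ x)
      = ∫⁻ x in halfBall3, ENNReal.ofReal (φ x ^ 2) := by
  simp only [← sq]
  exact ofReal_integral_eq_lintegral_ofReal (integrable_sq_of_mem_polySpace hφ)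
    (Filter.Eventually.of_forall fun x => sq_nonneg _)

theorem integral_halfBall3_mul_self_nonneg (φ : EuclideanSpace ℝ (Fin 3) → ℝ) :
    0 ≤ ∫ x in halfBall3, φ x * φ x :=
  integral_nonneg fun _ => mul_self_nonneg _

theorem sq_le_integral_halfBall3 {n : ℕ} (hn : 1 ≤ n) {φ : EuclideanSpace ℝ (Fin 3) → ℝ}
    (hφ : φ ∈ polySpace 3 n) {x : EuclideanSpace ℝ (Fin 3)} (hx : x ∈ halfBall3) :
    φ x ^ 2 ≤ 884736 * n ^ 5 * ∫ y in halfBall3, φ y * φ y := by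
  have h := sq_le_lintegral_halfBall3 hn hφ hx
  rw [← ofReal_integral_mul_self hφ, ← ENNReal.ofReal_mul (by positivity)] at h
  exact (ENNReal.ofReal_le_ofReal_iff
    (mul_nonneg (by positivity) (integral_halfBall3_mul_self_nonneg φ))).1 h

/-- This excludes the default value `0` of `christoffelC`. Definiteness follows from the upper
estimate itself: zero norm forces `f = 0` on the half ball, hence on the cube `[0, 1/2]³`, hence as
a polynomial. -/
theorem exists_isOrthonormalBasisOn_halfBall3 {n : ℕ} (hn : 1 ≤ n) :
    ∃ (N : ℕ) (φ : Fin N → EuclideanSpace ℝ (Fin 3) → ℝ),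
      IsOrthonormalBasisOn (polySpace 3 n) halfBall3 volume φ := by
  have _ : Module.Finite ℝ (polySpace 3 n) := by unfold polySpace; infer_instance
  refine exists_isOrthonormalBasisOn (fun f hf => memLp_of_mem_polySpace hf) fun f hf h0 => ?_
  have hz : ∀ x ∈ halfBall3, f x = 0 := fun x hx => by
    have := sq_le_integral_halfBall3 hn hf hx
    rw [h0, mul_zero] at this
    exact pow_eq_zero_iff two_ne_zero |>.1 (le_antisymm this (sq_nonneg _))
  obtain ⟨F, -, hF⟩ := exists_mvPolynomial_of_mem_polySpace hf
  have hF0 : F = 0 := by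
    refine MvPolynomial.funext_set (fun _ => Set.Icc (0 : ℝ) (1 / 2))
      (fun _ => Set.Icc_infinite (by norm_num)) fun z hz' => ?_
    have hb : ∀ i, 0 ≤ z i ∧ z i ≤ 1 / 2 := fun i => hz' i (Set.mem_univ i)
    have := hz (WithLp.toLp 2 z) ((mem_halfBall3_iff _).2
      ⟨by nlinarith [hb 0, hb 1, hb 2], (hb 2).1⟩)
    rw [hF] at this
    simpa using this
  funext x
  simp [hF, hF0]

theorem christoffelC_halfBall3_le {n : ℕ} (hn : 1 ≤ n) {x : EuclideanSpace ℝ (Fin 3)}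
    (hx : x ∈ halfBall3) : christoffelC (polySpace 3 n) halfBall3 volume x ≤ 884736 * n ^ 5 := by
  obtain ⟨N, φ, h⟩ := exists_isOrthonormalBasisOn_halfBall3 hn
  exact h.christoffelC_le (by positivity) fun f hf => sq_le_integral_halfBall3 hn hf hx

theorem le_christoffelC_edgePoint {n : ℕ} (hn : 1 ≤ n) :
    1 / 131072 * (n : ℝ) ^ 5 ≤ christoffelC (polySpace 3 n) halfBall3 volume edgePoint := by
  obtain ⟨N, φ, h⟩ := exists_isOrthonormalBasisOn_halfBall3 hn
  obtain ⟨f, hf, hpos, hle⟩ := exists_peaking_polynomial n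
  rw [← ofReal_integral_mul_self hf, ← ENNReal.ofReal_mul (by positivity),
    ENNReal.ofReal_le_ofReal_iff (sq_nonneg _)] at hle
  have hC := h.sq_le_christoffelC hf edgePoint
  -- If the norm vanished, Cauchy–Schwarz would force `f` to vanish at the edge point.
  have hI : 0 < ∫ y in halfBall3, f y * f y := by
    refine (integral_halfBall3_mul_self_nonneg f).lt_of_ne fun h0 => ?_
    rw [← h0, zero_mul] at hC
    nlinarith
  rw [mul_comm] at hle
  exact le_of_mul_le_mul_left (hle.trans hC) hI

/-! ### Nikolskii bounds on the half ball -/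

theorem eLpNorm_two_sq_halfBall3 (φ : EuclideanSpace ℝ (Fin 3) → ℝ) :
    eLpNorm φ 2 (volume.restrict halfBall3) ^ 2
      = ∫⁻ x in halfBall3, ENNReal.ofReal (φ x ^ 2) := by
  have h := eLpNorm_nnreal_pow_eq_lintegral (f := φ) (μ := volume.restrict halfBall3)
    (p := 2) two_ne_zero
  norm_num at h
  rw [h]
  refine lintegral_congr fun x => ?_
  rw [Real.enorm_eq_ofReal_abs, ← ENNReal.ofReal_pow (abs_nonneg _), sq_abs]

theorem ofReal_sqrt_mul_rpow_sq {K : ℝ} (hK : 0 ≤ K) (n : ℕ) :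
    ENNReal.ofReal (√K * (n : ℝ) ^ (5 / 2 : ℝ)) ^ 2 = ENNReal.ofReal (K * n ^ 5) := by
  rw [← ENNReal.ofReal_pow (by positivity), mul_pow, Real.sq_sqrt hK,
    ← Real.rpow_natCast ((n : ℝ) ^ (5 / 2 : ℝ)), ← Real.rpow_mul (by positivity)]
  norm_num

theorem eLpNorm_top_halfBall3_le {n : ℕ} (hn : 1 ≤ n) {φ : EuclideanSpace ℝ (Fin 3) → ℝ}
    (hφ : φ ∈ polySpace 3 n) : eLpNorm φ ∞ (volume.restrict halfBall3) ≤
      ENNReal.ofReal (√884736 * (n : ℝ) ^ (5 / 2 : ℝ)) *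
        eLpNorm φ 2 (volume.restrict halfBall3) := by
  rw [eLpNorm_exponent_top]
  refine eLpNormEssSup_le_of_ae_enorm_bound
    ((ae_restrict_iff' isCompact_halfBall3.measurableSet).2
      (Filter.Eventually.of_forall fun x hx => ?_))
  rw [← ENNReal.pow_le_pow_left_iff two_ne_zero, mul_pow, ofReal_sqrt_mul_rpow_sq (by norm_num),
    eLpNorm_two_sq_halfBall3, Real.enorm_eq_ofReal_abs, ← ENNReal.ofReal_pow (abs_nonneg _), sq_abs]
  exact sq_le_lintegral_halfBall3 hn hφ hx

/-- The essential supremum ignores null sets, and the peak sits on the boundary. In the open half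
ball the points exceeding it form an open null set, hence none exist; continuity then carries the
bound to the edge point. -/
theorem enorm_edgePoint_le_eLpNorm_top {φ : EuclideanSpace ℝ (Fin 3) → ℝ} (hφ : Continuous φ) :
    ‖φ edgePoint‖ₑ ≤ eLpNorm φ ∞ (volume.restrict halfBall3) := by
  rw [eLpNorm_exponent_top]
  set M := eLpNormEssSup φ (volume.restrict halfBall3) with hM
  have hae : ∀ᵐ x ∂(volume.restrict halfBall3), ‖φ x‖ₑ ≤ M := ae_le_eLpNormEssSup
  have hcl : IsClosed {x | ‖φ x‖ₑ ≤ M} := isClosed_le (by fun_prop) continuous_const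
  have hint : ∀ x : EuclideanSpace ℝ (Fin 3), ‖x‖ < 1 → 0 < x 2 → ‖φ x‖ₑ ≤ M := by
    set V : Set (EuclideanSpace ℝ (Fin 3)) := {x | ‖x‖ < 1} ∩ {x | 0 < x 2} ∩
      {x | ‖φ x‖ₑ ≤ M}ᶜ with hV
    have hVo : IsOpen V := ((isOpen_lt (by fun_prop) (by fun_prop)).inter
      (isOpen_lt (by fun_prop) (by fun_prop))).inter hcl.isOpen_compl
    have hV0 : volume V = 0 := by
      rw [ae_restrict_iff' isCompact_halfBall3.measurableSet] at hae
      refine measure_mono_null (fun x hx => ?_) hae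
      exact fun h => hx.2 (h ⟨le_of_lt hx.1.1, le_of_lt hx.1.2⟩)
    rw [hVo.measure_eq_zero_iff volume] at hV0
    intro x h1 h2
    by_contra h3
    exact (hV0 ▸ (show x ∈ V from ⟨⟨h1, h2⟩, h3⟩) : x ∈ (∅ : Set _)).elim
  -- These points are interior for `0 < ε < 1`, since `(1 - ε)² + ε²/4 < 1`.
  have hlim : Filter.Tendsto (fun ε : ℝ => (!₂[1 - ε, 0, ε / 2] : EuclideanSpace ℝ (Fin 3)))
      (nhdsWithin 0 (Set.Ioi 0)) (nhds edgePoint) := by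
    have hc : Continuous fun ε : ℝ => (!₂[1 - ε, 0, ε / 2] : EuclideanSpace ℝ (Fin 3)) :=
      (PiLp.continuous_toLp 2 _).comp (by fun_prop)
    have := (hc.tendsto 0).mono_left (nhdsWithin_le_nhds (s := Set.Ioi 0))
    simpa [edgePoint] using this
  refine hcl.mem_of_tendsto hlim ?_
  filter_upwards [Ioo_mem_nhdsGT (zero_lt_one' ℝ)] with ε hε
  refine hint _ ?_ (by simpa using hε.1)
  rw [← sq_lt_one_iff₀ (norm_nonneg _), EuclideanSpace.norm_sq_eq]
  simp [Fin.sum_univ_three]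
  nlinarith [hε.1, hε.2]

theorem le_nikolskiiSup_halfBall3 (n : ℕ) :
    ENNReal.ofReal (√(1 / 131072) * (n : ℝ) ^ (5 / 2 : ℝ)) ≤
      nikolskiiSup (polySpace 3 n) halfBall3 volume := by
  obtain ⟨f, hf, hpos, hle⟩ := exists_peaking_polynomial n
  have hf0 : f ≠ 0 := fun h => by simp [h] at hpos
  refine le_iSup₂_of_le f hf (le_iSup_of_le hf0 ?_)
  have htop := enorm_edgePoint_le_eLpNorm_top (continuous_of_mem_polySpace hf)
  have hne : ‖f edgePoint‖ₑ ≠ 0 := by simpa using hpos.ne'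
  rw [ENNReal.le_div_iff_mul_le (Or.inr (fun h => hne (le_antisymm (h ▸ htop) zero_le)))
    (Or.inl (memLp_of_mem_polySpace hf).2.ne)]
  refine le_trans ?_ htop
  rw [← ENNReal.pow_le_pow_left_iff two_ne_zero, mul_pow, ofReal_sqrt_mul_rpow_sq (by norm_num),
    eLpNorm_two_sq_halfBall3, Real.enorm_eq_ofReal_abs, ← ENNReal.ofReal_pow (abs_nonneg _), sq_abs]
  exact hle

theorem nikolskiiSup_halfBall3_le {n : ℕ} (hn : 1 ≤ n) :
    nikolskiiSup (polySpace 3 n) halfBall3 volume ≤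
      ENNReal.ofReal (√884736 * (n : ℝ) ^ (5 / 2 : ℝ)) :=
  iSup₂_le fun _ hφ => iSup_le fun _ => ENNReal.div_le_of_le_mul (eLpNorm_top_halfBall3_le hn hφ)

theorem mainTheorem8 :
    EquivOrder (fun n => christoffelSup (polySpace 3 n) halfBall3 volume)
        (fun n => (n : ℝ) ^ 5) ∧
      EquivOrder (fun n => nikolskiiSup (polySpace 3 n) halfBall3 volume)
        (fun n => (n : ℝ) ^ (5 / 2 : ℝ)) := by
  refine ⟨⟨1 / 131072, 884736, by norm_num, by norm_num, fun n hn => ⟨?_, ?_⟩⟩,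
    ⟨√(1 / 131072), √884736, by positivity, by positivity, fun n hn =>
      ⟨le_nikolskiiSup_halfBall3 n, nikolskiiSup_halfBall3_le hn⟩⟩⟩
  · exact le_iSup₂_of_le edgePoint edgePoint_mem
      (ENNReal.ofReal_le_ofReal (le_christoffelC_edgePoint hn))
  · exact iSup₂_le fun x hx => ENNReal.ofReal_le_ofReal (christoffelC_halfBall3_le hn hx)
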